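/- **A $1$-isospectral pair with holonomy group $D_4$.** For $B\in \mathrm{O}(4)$ and $b\in\mathbb R^4$ let $BL_b$ denote the isometry $x\mapsto B(x+b)$ of $\mathbb R^4$, and let $e_1,\dots,e_4$ be the standard basis. Put $$B_1=\begin{pmatrix}1&0&0&0\\0&1&0&0\\0&0&0&1\\0&0&-1&0\end{pmatrix},\qquad B_2=\begin{pmatrix}-1&0&0&0\\0&1&0&0\\0&0&0&1\\0&0&1&0\end{pmatrix},$$ and let $\Gamma_{60}$ (respectively $\Gamma_{61}$) be the group of isometries of $\mathbb R^4$ generated by $B_1L_{e_1/4}$ (respectively $B_1L_{e_1/4+e_4/2}$), by $B_2L_{e_2/2}$, and by all translations by vectors of $\mathbb Z^4$. Then $\Gamma_{60}$ and $\Gamma_{61}$ are Bieberbach groups (discrete, cocompact, torsion-free groups of isometries of $\mathbb R^4$). In each of them the translations are exactly those by vectors of $\mathbb Z^4$, and the holonomy group (the quotient of the group by its subgroup of translations) is isomorphic to the dihedral group $D_4$ of order $8$. Let $M_{60}=\Gamma_{60}\backslash\mathbb R^4$ and $M_{61}=\Gamma_{61}\backslash\mathbb R^4$ be the corresponding compact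 flat manifolds. Call two such manifolds $p$-isospectral if the Laplacians acting on their smooth $p$-forms have the same eigenvalues with the same multiplicities. Here smooth $p$-forms on $\Gamma\backslash\mathbb R^4$ are the (complex-valued) smooth $\Gamma$-invariant $p$-forms on $\mathbb R^4$, and the Laplacian is the connection Laplacian $-\sum_i\partial^2/\partial x_i^2$ acting on coefficients, which for flat manifolds is the Hodge Laplacian. Then $M_{60}$ and $M_{61}$ are $1$-isospectral and $3$-isospectral, but they are not $p$-isospectral for $p=0,2,4$. More precisely, the multiplicity of $4\pi^2$ as an eigenvalue of the Laplacian on $p$-forms (zero when $4\pi^2$ is not an eigenvalue) is $1$ for $M_{60}$ and $0$ for $M_{61}$ if $p=0$ or $p=4$, and is $8$ for $M_{60}$ and $10$ for $M_{61}$ if $p=2$. -/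

import Mathlib

open scoped ContDiff

noncomputable section

namespace FlatManifold

/-- Euclidean space `ℝⁿ`. -/
abbrev Euc (n : ℕ) : Type := EuclideanSpace ℝ (Fin n)

/-- The isometry group `I(ℝⁿ)`. -/
abbrev Isom (n : ℕ) : Type := Euc n ≃ᵃⁱ[ℝ] Euc n

/-! ### Bieberbach groups -/

/-- The homomorphism `B L_b ↦ B` from `I(ℝⁿ)` to `O(n)`. -/
def linearPart (n : ℕ) : Isom n →* (Euc n ≃ₗᵢ[ℝ] Euc n) where
  toFun γ := γ.linearIsometryEquiv
  map_one' := rfl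
  map_mul' _ _ := rfl

/-- The translation `L_b : x ↦ x + b`. -/
def translation {n : ℕ} (b : Euc n) : Isom n := AffineIsometryEquiv.constVAdd ℝ (Euc n) b

/-- The isometry `B L_b : x ↦ B (x + b)` for an orthogonal matrix `B` and a vector `b`. -/
def motion {n : ℕ} (B : Matrix.orthogonalGroup (Fin n) ℝ) (b : Euc n) : Isom n :=
  (Unitary.linearIsometryEquiv
    ⟨Matrix.toEuclideanCLM (n := Fin n) (𝕜 := ℝ) B.1, by
      exact Unitary.map_mem (Matrix.toEuclideanCLM (n := Fin n) (𝕜 := ℝ)) B.2⟩).toAffineIsometryEquiv *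
    translation b

theorem motion_apply {n : ℕ} (B : Matrix.orthogonalGroup (Fin n) ℝ) (b x : Euc n) :
    motion B b x = WithLp.toLp 2 (B.1.mulVec (WithLp.ofLp (x + b))) := by
  rw [add_comm]
  rfl

/-- An isometry of `ℝⁿ` as a point of the space of continuous maps `ℝⁿ → ℝⁿ`, which carries the
compact-open topology. -/
def toContinuousMap {n : ℕ} (γ : Isom n) : C(Euc n, Euc n) := ⟨γ, γ.continuous⟩

/-- A Bieberbach group: a discrete, cocompact, torsion-free subgroup of `I(ℝⁿ)`. -/
structure IsBieberbach {n : ℕ} (Γ : Subgroup (Isom n)) : Prop where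
  discrete : IsDiscrete (toContinuousMap '' (Γ : Set (Isom n)))
  cocompact : ∃ K : Set (Euc n), IsCompact K ∧ ∀ x, ∃ γ ∈ Γ, γ x ∈ K
  torsionFree : ∀ γ ∈ Γ, IsOfFinOrder γ → γ = 1

/-- The subgroup of translations in `Γ`. -/
def translations {n : ℕ} (Γ : Subgroup (Isom n)) : Subgroup Γ :=
  ((linearPart n).comp Γ.subtype).ker

instance {n : ℕ} (Γ : Subgroup (Isom n)) : (translations Γ).Normal :=
  MonoidHom.normal_ker _

/-- The holonomy group `F = Λ \ Γ`. -/
abbrev Holonomy {n : ℕ} (Γ : Subgroup (Isom n)) : Type := Γ ⧸ translations Γ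

/-- The canonical lattice `ℤⁿ ⊆ ℝⁿ`. -/
def canonicalLattice (n : ℕ) : Set (Euc n) := {v | ∀ i, ∃ m : ℤ, v i = m}

/-- The translation lattice of `Γ` is the canonical lattice. -/
def HasCanonicalLattice {n : ℕ} (Γ : Subgroup (Isom n)) : Prop :=
  ∀ b : Euc n, translation b ∈ Γ ↔ b ∈ canonicalLattice n

/-! ### The spectrum on `p`-forms of `M_Γ = Γ \ ℝⁿ` -/

/-- Complex-valued `p`-forms on `ℝⁿ` (no regularity imposed). -/
abbrev Form (n p : ℕ) : Type := Euc n → (Euc n) [⋀^Fin p]→L[ℝ] ℂ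

/-- The pullback `γ^* η`; the derivative of `γ` at every point is its linear part. -/
def pullback {n p : ℕ} (γ : Isom n) (η : Form n p) : Form n p := fun x =>
  (η (γ x)).compContinuousLinearMap ((linearPart n γ).toContinuousLinearEquiv : Euc n →L[ℝ] Euc n)

/-- The smooth `p`-forms on `M_Γ = Γ \ ℝⁿ`, that is, the `Γ`-invariant smooth `p`-forms on `ℝⁿ`,
satisfying `-Δ η = lam η`, where `-Δ = -∑ ∂²/∂xᵢ²` acts on the coefficients of `η`. This is the
connection Laplacian of the flat metric, which agrees with the Hodge Laplacian `d δ + δ d`. -/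
def eigenforms {n : ℕ} (Γ : Subgroup (Isom n)) (p : ℕ) (lam : ℝ) : Submodule ℂ (Form n p) where
  carrier := {η | ContDiff ℝ ∞ η ∧ (∀ γ ∈ Γ, pullback γ η = η) ∧
    ∀ x, -(Laplacian.laplacian η : Form n p) x = lam • η x}
  zero_mem' := by
    refine ⟨contDiff_const, fun γ _ => rfl, fun x => ?_⟩
    have h : (Laplacian.laplacian (0 : Form n p) : Form n p) = 0 :=
      InnerProductSpace.laplacian_const (c := (0 : (Euc n) [⋀^Fin p]→L[ℝ] ℂ))
    rw [h]
    simp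
  add_mem' := by
    rintro η θ ⟨h1, h2, h3⟩ ⟨k1, k2, k3⟩
    refine ⟨h1.add k1, fun γ hγ => ?_, fun x => ?_⟩
    · conv_rhs => rw [← h2 γ hγ, ← k2 γ hγ]
      rfl
    · rw [ContDiffAt.laplacian_add (h1.contDiffAt.of_le ENat.LEInfty.out)
        (k1.contDiffAt.of_le ENat.LEInfty.out), neg_add, h3, k3, Pi.add_apply, smul_add]
  smul_mem' := by
    rintro c η ⟨h1, h2, h3⟩
    refine ⟨h1.const_smul c, fun γ hγ => ?_, fun x => ?_⟩
    · conv_rhs => rw [← h2 γ hγ]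
      rfl
    · rw [InnerProductSpace.laplacian_smul c (h1.contDiffAt.of_le ENat.LEInfty.out), ← smul_neg, h3,
        smul_comm]
      rfl

/-- The multiplicity of `lam` as an eigenvalue of the Laplacian on `p`-forms of `M_Γ` (zero if
`lam` is not an eigenvalue). -/
def eigenMultiplicity {n : ℕ} (Γ : Subgroup (Isom n)) (p : ℕ) (lam : ℝ) : Cardinal :=
  Module.rank ℂ (eigenforms Γ p lam)

/-- `M_Γ` and `M_Γ'` are `p`-isospectral: the Laplacians on `p`-forms have the same eigenvalues
with the same multiplicities. -/
def Isospectral {n : ℕ} (p : ℕ) (Γ Γ' : Subgroup (Isom n)) : Prop :=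
  ∀ lam : ℝ, eigenMultiplicity Γ p lam = eigenMultiplicity Γ' p lam

/-! ### The groups -/

/-- The matrix `d(I, J̃)`. -/
def B₁ : Matrix.orthogonalGroup (Fin 4) ℝ :=
  ⟨!![1, 0, 0, 0; 0, 1, 0, 0; 0, 0, 0, 1; 0, 0, -1, 0], by
    rw [Matrix.mem_orthogonalGroup_iff]
    ext i j
    fin_cases i <;> fin_cases j <;> simp [Matrix.mul_apply, Fin.sum_univ_succ]⟩

/-- The matrix `d(Ĩ, J)`. -/
def B₂ : Matrix.orthogonalGroup (Fin 4) ℝ :=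
  ⟨!![-1, 0, 0, 0; 0, 1, 0, 0; 0, 0, 0, 1; 0, 0, 1, 0], by
    rw [Matrix.mem_orthogonalGroup_iff]
    ext i j
    fin_cases i <;> fin_cases j <;> simp [Matrix.mul_apply, Fin.sum_univ_succ]⟩

/-- The group `Γ₆₀`, generated by `B₁ L_{e₁/4}`, `B₂ L_{e₂/2}` and the translations by `ℤ⁴`. -/
def Γ₆₀ : Subgroup (Isom 4) :=
  Subgroup.closure ({motion B₁ !₂[1 / 4, 0, 0, 0], motion B₂ !₂[0, 1 / 2, 0, 0]} ∪
    translation '' canonicalLattice 4)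

/-- The group `Γ₆₁`, generated by `B₁ L_{e₁/4 + e₄/2}`, `B₂ L_{e₂/2}` and the translations by
`ℤ⁴`. -/
def Γ₆₁ : Subgroup (Isom 4) :=
  Subgroup.closure ({motion B₁ !₂[1 / 4, 0, 0, 1 / 2], motion B₂ !₂[0, 1 / 2, 0, 0]} ∪
    translation '' canonicalLattice 4)

end FlatManifold

end

open FlatManifold

/-!
Each of the two groups is an extension of the dihedral group of order `8` by `ℤ⁴`. The extension is
described by a `HolonomyDatum`: orthogonal integer matrices `R_g`, and translation parts in `(¼ℤ)⁴`
that form a cocycle modulo `ℤ⁴`. The lattice, the holonomy group, discreteness and cocompactness can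
be read off from such data; the group is torsion-free because each `g ≠ 1` fixes a covector (`e₁` for
rotations, `e₂` for reflections) whose pairing with the translation part over `g` is not an integer,
so that the powers of an isometry over `g` move every point away in that direction.

Fourier analysis on the torus reduces the spectrum to finite-dimensional linear algebra. A smooth
periodic `p`-form with eigenvalue `lam` is a trigonometric polynomial whose frequencies are the
finitely many `v ∈ ℤⁿ` with `4π²‖v‖² = lam` (`exists_trigPoly_eq`), because differentiation multiplies
Fourier coefficients by `2πi v_j` (`mFourierCoeff_partialDeriv`). The group acts on the coefficients of
these polynomials through its holonomy group, and the eigenforms are the invariants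
(`HolonomyDatum.Realizes.eigenforms_eq`). An element `g` permutes the frequencies, multiplies by
fourth roots of unity and acts on constant `p`-forms, so its trace is

  `tr (R_g on p-forms) * ∑ exp (2πi w·t_g)`, the sum running over the frequencies `w` fixed by `R_g`,

where the first factor is a sum of principal minors (`trace_formPullback`). The multiplicity is the
average of these traces (`HolonomyDatum.card_mul_finrank_invariants`).

The two groups have the same matrices. On `1`-forms and `3`-forms only the rotations `1`, `B₁`, `B₁³`
have nonzero trace, and over these the translation parts pair equally with every fixed frequency
(`HolonomyDatum.Realizes.isospectral`), hence all multiplicities agree. At the eigenvalue `4π²` there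
are eight frequencies, and the multiplicities are finite sums of integers that are evaluated directly.
-/

noncomputable section

namespace FlatManifold

/-! ### Fourier series of periodic functions -/

section Fourier

open MeasureTheory UnitAddTorus

/-- The volume on `ℝ / ℤ` normalised to total mass one, as in Mathlib's Fourier theory on
`UnitAddTorus`. -/
local instance : MeasureSpace UnitAddCircle := ⟨AddCircle.haarAddCircle⟩

local instance : Measure.IsAddHaarMeasure (volume : Measure UnitAddCircle) :=
  inferInstanceAs (Measure.IsAddHaarMeasure AddCircle.haarAddCircle)

local instance : IsProbabilityMeasure (volume : Measure UnitAddCircle) :=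
  inferInstanceAs (IsProbabilityMeasure AddCircle.haarAddCircle)

/-- A function on `ℝⁿ` is periodic if it is invariant under translation by `ℤⁿ`. -/
def IsPeriodic {n : ℕ} {F : Type*} (f : Euc n → F) : Prop :=
  ∀ b ∈ canonicalLattice n, ∀ x, f (x + b) = f x

/-- The projection `ℝⁿ → ℝⁿ / ℤⁿ`. -/
def toTorus {n : ℕ} (x : Euc n) : UnitAddTorus (Fin n) := fun i => (x i : UnitAddCircle)

theorem toTorus_add {n : ℕ} (x y : Euc n) : toTorus (x + y) = toTorus x + toTorus y := by
  ext i; simp [toTorus]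

theorem isOpenQuotientMap_toTorus {n : ℕ} : IsOpenQuotientMap (toTorus (n := n)) := by
  have h : IsOpenQuotientMap (Pi.map fun (_ : Fin n) (t : ℝ) => (t : UnitAddCircle)) :=
    IsOpenQuotientMap.piMap fun _ => QuotientAddGroup.isOpenQuotientMap_mk
  exact h.comp (PiLp.homeomorph 2 _).isOpenQuotientMap

/-- A continuous periodic function descends to the torus. -/
theorem exists_descent {n : ℕ} {f : Euc n → ℂ} (hf : Continuous f) (hp : IsPeriodic f) :
    ∃ F : C(UnitAddTorus (Fin n), ℂ), ∀ x, F (toTorus x) = f x := by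
  have key : ∀ x y : Euc n, toTorus x = toTorus y → f x = f y := by
    intro x y h
    have : x - y ∈ canonicalLattice n := by
      intro i
      have hi : ((x i - y i : ℝ) : UnitAddCircle) = 0 := by
        rw [AddCircle.coe_sub]
        exact sub_eq_zero.mpr (congrFun h i)
      obtain ⟨m, hm⟩ := (AddCircle.coe_eq_zero_iff (1 : ℝ)).mp hi
      exact ⟨m, by simpa using hm.symm⟩
    have := hp _ this y
    rwa [add_sub_cancel] at this
  let q : C(Euc n, UnitAddTorus (Fin n)) := ⟨toTorus, isOpenQuotientMap_toTorus.continuous⟩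
  have hq : Topology.IsQuotientMap q := isOpenQuotientMap_toTorus.isQuotientMap
  exact ⟨hq.lift ⟨f, hf⟩ key, fun x => DFunLike.congr_fun (hq.lift_comp ⟨f, hf⟩ key) x⟩

/-- The character `x ↦ exp (2πi v·x)` of `ℝⁿ`. -/
def expChar {n : ℕ} (v : Fin n → ℤ) (x : Euc n) : ℂ :=
  Complex.exp (2 * Real.pi * Complex.I * ((∑ i, v i * x i : ℝ) : ℂ))

theorem mFourier_toTorus {n : ℕ} (v : Fin n → ℤ) (x : Euc n) :
    mFourier v (toTorus x) = expChar v x := by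
  simp only [mFourier, toTorus, ContinuousMap.coe_mk, fourier_coe_apply, expChar,
    ← Complex.exp_sum]
  congr 1
  push_cast
  rw [Finset.mul_sum]
  refine Finset.sum_congr rfl fun i _ => ?_
  ring

theorem mFourier_add_apply {n : ℕ} (v : Fin n → ℤ) (s t : UnitAddTorus (Fin n)) :
    mFourier v (s + t) = mFourier v s * mFourier v t := by
  simp [mFourier, Finset.prod_mul_distrib, fourier_apply, smul_add, AddCircle.toCircle_add]

/-- Translating a function on the torus multiplies its Fourier coefficients by a character. -/
theorem mFourierCoeff_translate {n : ℕ} (F : C(UnitAddTorus (Fin n), ℂ)) (v : Fin n → ℤ)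
    (y : UnitAddTorus (Fin n)) :
    ∫ t, mFourier (-v) t * F (t + y) = mFourier v y * mFourierCoeff F v := by
  have h := integral_add_right_eq_self (μ := (volume : Measure (UnitAddTorus (Fin n))))
    (fun t => mFourier (-v) (t - y) * F t) y
  simp only [add_sub_cancel_right] at h
  rw [h, mFourierCoeff, ← integral_const_mul]
  refine integral_congr_ae (Filter.Eventually.of_forall fun t => ?_)
  have h1 : mFourier (-v) (-y) = mFourier v y := by
    simp [mFourier, fourier_apply]
  simp only [sub_eq_add_neg, mFourier_add_apply, h1, smul_eq_mul]
  ring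

/-- The Fourier coefficients of a partial derivative, obtained by differentiating the effect of a
translation in that direction (`mFourierCoeff_translate`) under the integral sign. -/
theorem mFourierCoeff_partialDeriv {n : ℕ} {f : Euc n → ℂ} (hf : ContDiff ℝ 1 f)
    (j : Fin n) {F F' : C(UnitAddTorus (Fin n), ℂ)} (hF : ∀ x, F (toTorus x) = f x)
    (hF' : ∀ x, F' (toTorus x) = fderiv ℝ f x (EuclideanSpace.single j 1)) (v : Fin n → ℤ) :
    mFourierCoeff F' v = 2 * Real.pi * Complex.I * v j * mFourierCoeff F v := by
  set e : Euc n := EuclideanSpace.single j 1 with he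
  have hG : HasDerivAt (fun s : ℝ => ∫ t, mFourier (-v) t * F (t + toTorus (s • e)))
      (∫ t, mFourier (-v) t * F' (t + toTorus ((0:ℝ) • e))) 0 := by
    have hcont : Continuous (toTorus (n := n)) := isOpenQuotientMap_toTorus.continuous
    refine (hasDerivAt_integral_of_dominated_loc_of_deriv_le (μ := volume)
      (s := Set.univ) (bound := fun _ => ‖F'‖) (F' := fun s t => mFourier (-v) t * F' (t + toTorus (s • e)))
      Filter.univ_mem ?_ ?_ ?_ ?_ ?_ ?_).2
    · refine Filter.Eventually.of_forall fun s => Continuous.aestronglyMeasurable ?_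
      fun_prop
    · refine Continuous.integrable_of_hasCompactSupport (by fun_prop) (HasCompactSupport.of_compactSpace _)
    · refine Continuous.aestronglyMeasurable ?_
      fun_prop
    · refine Filter.Eventually.of_forall fun t s _ => ?_
      rw [norm_mul]
      have h1 : ‖mFourier (-v) t‖ ≤ 1 := by
        simpa only [mFourier_norm] using (mFourier (-v)).norm_coe_le_norm t
      calc _ ≤ 1 * ‖F'‖ := by gcongr; exact F'.norm_coe_le_norm _
        _ = _ := one_mul _
    · exact integrable_const _
    · refine Filter.Eventually.of_forall fun t s _ => HasDerivAt.const_mul _ ?_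
      obtain ⟨x, rfl⟩ := isOpenQuotientMap_toTorus.surjective t
      simp only [← toTorus_add, hF, hF']
      have h1 : HasFDerivAt f (fderiv ℝ f (x + s • e)) (x + s • e) :=
        (hf.differentiable one_ne_zero _).hasFDerivAt
      have h2 : HasDerivAt (fun s : ℝ => x + s • e) e s := by
        simpa using ((hasDerivAt_id s).smul_const e).const_add x
      exact h1.comp_hasDerivAt s h2
  have h0 : toTorus ((0:ℝ) • e) = 0 := by
    ext i; simp [toTorus]
  rw [h0] at hG
  simp only [add_zero, mFourierCoeff_translate, mFourier_toTorus] at hG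
  have hE : HasDerivAt (fun s : ℝ => expChar v (s • e) * mFourierCoeff F v)
      (2 * Real.pi * Complex.I * v j * mFourierCoeff F v) 0 := by
    refine HasDerivAt.mul_const ?_ _
    have h1 : (fun s : ℝ => expChar v (s • e)) =
        fun s : ℝ => Complex.exp (2 * Real.pi * Complex.I * v j * (s : ℂ)) := by
      funext s
      simp only [expChar, he]
      congr 1
      have : ∑ i, (v i : ℝ) * (s • (EuclideanSpace.single j (1:ℝ) : Euc n)) i = v j * s := by
        rw [Finset.sum_eq_single j]
        · simp
        · intro b _ hb; simp [hb]
        · simp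
      rw [this]; push_cast; ring
    rw [h1]
    have h2 : HasDerivAt (fun s : ℝ => 2 * Real.pi * Complex.I * v j * (s : ℂ))
      (2 * Real.pi * Complex.I * v j) 0 := by
      simpa using (Complex.ofRealCLM.hasDerivAt (x := (0:ℝ))).const_mul (2 * Real.pi * Complex.I * v j)
    simpa using h2.cexp
  exact hG.unique hE

/-! ### Periodic eigenfunctions of the Laplacian -/

/-- The `v ∈ ℤⁿ` with `4π²‖v‖² = lam`: the frequencies of the periodic functions with Laplace
eigenvalue `lam`. -/
def frequencies (n : ℕ) (lam : ℝ) : Set (Fin n → ℤ) :=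
  {v | 4 * Real.pi ^ 2 * ((∑ i, v i ^ 2 : ℤ) : ℝ) = lam}

theorem frequencies_finite (n : ℕ) (lam : ℝ) : (frequencies n lam).Finite := by
  obtain ⟨N, hN⟩ := exists_nat_ge (lam / (4 * Real.pi ^ 2))
  refine (Set.finite_Icc (fun _ => -(N : ℤ)) (fun _ => (N : ℤ))).subset fun v hv => ?_
  have h1 : ∑ i, v i ^ 2 ≤ (N : ℤ) := by
    have : ((∑ i, v i ^ 2 : ℤ) : ℝ) ≤ N := by
      refine le_trans (le_of_eq ?_) hN
      rw [← Set.mem_ofPred.mp hv]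
      field_simp
    exact_mod_cast this
  have h2 : ∀ i, v i ^ 2 ≤ (N : ℤ) := fun i =>
    (Finset.single_le_sum (f := fun i => v i ^ 2) (fun i _ => sq_nonneg _) (Finset.mem_univ i)).trans h1
  refine ⟨fun i => ?_, fun i => ?_⟩
  · have := h2 i
    show -(N : ℤ) ≤ v i
    nlinarith
  · have := h2 i
    show v i ≤ (N : ℤ)
    nlinarith

instance (n : ℕ) (lam : ℝ) : Fintype (frequencies n lam) := (frequencies_finite n lam).fintype

theorem laplacian_eq_sum_partialDeriv {n : ℕ} {F : Type*} [NormedAddCommGroup F]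
    [NormedSpace ℝ F] {f : Euc n → F} (hf : ContDiff ℝ ∞ f) (x : Euc n) :
    Laplacian.laplacian f x = ∑ j, fderiv ℝ
      (fun y => fderiv ℝ f y (EuclideanSpace.single j 1)) x (EuclideanSpace.single j 1) := by
  rw [InnerProductSpace.laplacian_eq_iteratedFDeriv_orthonormalBasis f
    (EuclideanSpace.basisFun (Fin n) ℝ)]
  refine Finset.sum_congr rfl fun j _ => ?_
  have hd : DifferentiableAt ℝ (fderiv ℝ f) x :=
    (hf.fderiv_right (m := ∞) (by simp)).differentiable (by simp) x
  rw [iteratedFDeriv_two_apply, fderiv_clm_apply hd (differentiableAt_const _)]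
  simp

theorem IsPeriodic.fderiv_apply {n : ℕ} {f : Euc n → ℂ} (hp : IsPeriodic f) (e : Euc n) :
    IsPeriodic fun x => fderiv ℝ f x e := by
  intro b hb x
  have : (fun y => f (y + b)) = f := funext (hp b hb)
  show fderiv ℝ f (x + b) e = fderiv ℝ f x e
  rw [← fderiv_comp_add_right, this]

/-- Comparing the Fourier coefficients of the two sides of `-Δ f = lam f` gives
`4π²‖v‖² c_v = lam c_v`. -/
theorem mFourierCoeff_eq_zero_of_eigenfunction {n : ℕ} {f : Euc n → ℂ} {lam : ℝ}
    (hf : ContDiff ℝ ∞ f) (hp : IsPeriodic f)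
    (hlam : ∀ x, -(Laplacian.laplacian f : Euc n → ℂ) x = lam • f x)
    {F : C(UnitAddTorus (Fin n), ℂ)} (hF : ∀ x, F (toTorus x) = f x) {v : Fin n → ℤ}
    (hv : v ∉ frequencies n lam) : mFourierCoeff F v = 0 := by
  have hD : ∀ {g : Euc n → ℂ}, ContDiff ℝ ∞ g → ∀ e : Euc n, ContDiff ℝ ∞ fun x => fderiv ℝ g x e :=
    fun hg e => (hg.fderiv_right (m := ∞) (by simp)).clm_apply contDiff_const
  have hD1 : ∀ {g : Euc n → ℂ}, ContDiff ℝ ∞ g → ContDiff ℝ 1 g :=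
    fun hg => hg.of_le (by exact_mod_cast le_top)
  choose F₁ hF₁ using fun j : Fin n =>
    exists_descent (hD hf (EuclideanSpace.single j 1)).continuous (hp.fderiv_apply _)
  choose F₂ hF₂ using fun j : Fin n =>
    exists_descent (hD (hD hf (EuclideanSpace.single j 1)) (EuclideanSpace.single j 1)).continuous
      ((hp.fderiv_apply _).fderiv_apply _)
  have h1 : ∀ j, mFourierCoeff (F₂ j) v = -(4 * Real.pi ^ 2 * (v j : ℂ) ^ 2) * mFourierCoeff F v := by
    intro j
    rw [mFourierCoeff_partialDeriv (hD1 (hD hf _)) j (hF₁ j) (hF₂ j),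
      mFourierCoeff_partialDeriv (hD1 hf) j hF (hF₁ j)]
    linear_combination (4 * (Real.pi : ℂ) ^ 2 * (v j : ℂ) ^ 2 * mFourierCoeff F v) * Complex.I_sq
  have h2 : ∑ j, mFourierCoeff (F₂ j) v = -lam * mFourierCoeff F v := by
    simp only [mFourierCoeff, smul_eq_mul]
    rw [← integral_finsetSum, ← integral_const_mul]
    · congr 1
      funext t
      obtain ⟨x, rfl⟩ := isOpenQuotientMap_toTorus.surjective t
      have := hlam x
      rw [laplacian_eq_sum_partialDeriv hf, Complex.real_smul] at this
      simp only [hF, hF₂, ← Finset.mul_sum]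
      rw [neg_eq_iff_eq_neg.mp this]
      ring
    · intro j _
      exact Continuous.integrable_of_hasCompactSupport (by fun_prop)
        (HasCompactSupport.of_compactSpace _)
  simp only [h1, ← Finset.sum_mul, Finset.sum_neg_distrib, ← Finset.mul_sum] at h2
  by_contra hc
  have h3 := mul_right_cancel₀ hc h2
  apply hv
  have h4 : (4 * Real.pi ^ 2 * ∑ j, (v j : ℂ) ^ 2) = (lam : ℂ) := by simpa using h3
  show 4 * Real.pi ^ 2 * ((∑ i, v i ^ 2 : ℤ) : ℝ) = lam
  exact_mod_cast h4

/-- A smooth periodic Laplace eigenfunction is a trigonometric polynomial: its Fourier series is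
supported on the finitely many frequencies belonging to the eigenvalue. -/
theorem exists_eq_sum_expChar {n : ℕ} {f : Euc n → ℂ} {lam : ℝ}
    (hf : ContDiff ℝ ∞ f) (hp : IsPeriodic f)
    (hlam : ∀ x, -(Laplacian.laplacian f : Euc n → ℂ) x = lam • f x) :
    ∃ c : frequencies n lam → ℂ, ∀ x, f x = ∑ v, expChar v.1 x * c v := by
  obtain ⟨F, hF⟩ := exists_descent hf.continuous hp
  have h0 : ∀ v ∉ (frequencies n lam).toFinset, mFourierCoeff F v = 0 := fun v hv =>
    mFourierCoeff_eq_zero_of_eigenfunction hf hp hlam hF (by simpa using hv)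
  refine ⟨fun v => mFourierCoeff F v.1, fun x => ?_⟩
  have hs := hasSum_mFourier_series_apply_of_summable
    (summable_of_ne_finset_zero h0) (toTorus x)
  have h1 := hs.unique (hasSum_sum_of_ne_finset_zero
    (s := (frequencies n lam).toFinset) fun v hv => by rw [h0 v hv, zero_smul])
  rw [← hF, h1, Finset.sum_subtype _ (p := (· ∈ frequencies n lam)) (by simp)]
  refine Finset.sum_congr rfl fun v _ => ?_
  rw [mFourier_toTorus, smul_eq_mul, mul_comm]

theorem expChar_add {n : ℕ} (v : Fin n → ℤ) (x y : Euc n) :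
    expChar v (x + y) = expChar v x * expChar v y := by
  rw [← mFourier_toTorus, toTorus_add, mFourier_add_apply, mFourier_toTorus, mFourier_toTorus]

theorem expChar_injective {n : ℕ} : Function.Injective (expChar (n := n)) := by
  intro v w h
  by_contra hvw
  obtain ⟨j, hj⟩ := Function.ne_iff.mp hvw
  have hr : ((v j : ℝ) - w j) ≠ 0 := sub_ne_zero.mpr (by exact_mod_cast hj)
  have hx : ∀ u : Fin n → ℤ, ∀ s : ℝ, expChar u (EuclideanSpace.single j s) =
      Complex.exp (2 * Real.pi * Complex.I * (u j * s)) := by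
    intro u s
    simp only [expChar]
    congr 2
    rw [Finset.sum_eq_single j]
    · simp
    · intro b _ hb; simp [hb]
    · simp
  have h1 := congrFun h (EuclideanSpace.single j (1 / (2 * ((v j : ℝ) - w j))))
  rw [hx, hx, Complex.exp_eq_exp_iff_exists_int] at h1
  obtain ⟨k, hk⟩ := h1
  have hr' : ((v j : ℂ) - w j) ≠ 0 := by exact_mod_cast hr
  have h2 : ((v j : ℂ) - w j) * (1 / (2 * ((v j : ℂ) - w j))) = k := by
    have h2pi : (2 * Real.pi * Complex.I : ℂ) ≠ 0 := Complex.two_pi_I_ne_zero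
    apply mul_left_cancel₀ h2pi
    push_cast at hk
    linear_combination hk
  have h3 : (2 * k : ℂ) = 1 := by
    rw [← h2]
    field_simp
  have h4 : 2 * k = 1 := by exact_mod_cast h3
  omega

/-- The functions `expChar v` are linearly independent, being distinct characters. -/
theorem linearIndependent_expChar {n : ℕ} : LinearIndependent ℂ (expChar (n := n)) := by
  let χ : (Fin n → ℤ) → (Multiplicative (Euc n) →* ℂ) := fun v =>
    { toFun := fun x => expChar v x.toAdd
      map_one' := by simp [expChar]
      map_mul' := fun x y => expChar_add v _ _ }
  have hχ : Function.Injective χ := fun v w h => expChar_injective <| by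
    funext x; exact DFunLike.congr_fun h (Multiplicative.ofAdd x)
  exact (linearIndependent_monoidHom (Multiplicative (Euc n)) ℂ).comp χ hχ

end Fourier

open Matrix

/-! ### The space of constant `p`-forms -/

/-- The increasing `p`-tuples in `{0, …, n - 1}`; they index the coordinate `p`-forms
`dx_I = dx_{I 0} ∧ ⋯ ∧ dx_{I (p - 1)}`. -/
abbrev IncTuple (n p : ℕ) : Type := {I : Fin p → Fin n // StrictMono I}

instance (n p : ℕ) (I : Fin p → Fin n) : Decidable (StrictMono I) :=
  inferInstanceAs (Decidable (∀ a b, a < b → I a < I b))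

/-- The standard basis vector `e_i` of `ℝⁿ`. -/
abbrev stdVec {n : ℕ} (i : Fin n) : Euc n := EuclideanSpace.single i 1

/-- The coordinate form `dx_I`, whose value on vectors is a minor of their coordinate matrix. -/
def coordForm {n p : ℕ} (I : IncTuple n p) : (Euc n) [⋀^Fin p]→L[ℝ] ℂ :=
  { Complex.ofRealCLM.toLinearMap.compAlternatingMap
      ((Matrix.detRowAlternating (R := ℝ) (n := Fin p)).compLinearMap
        (LinearMap.pi fun l => (EuclideanSpace.proj (I.1 l) : Euc n →L[ℝ] ℝ).toLinearMap)) with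
    cont := by
      refine Complex.continuous_ofReal.comp (Continuous.matrix_det ?_)
      exact continuous_matrix fun k l => by
        show Continuous fun v : Fin p → Euc n => v k (I.1 l)
        fun_prop }

theorem coordForm_apply {n p : ℕ} (I : IncTuple n p) (v : Fin p → Euc n) :
    coordForm I v = ((Matrix.of fun k l => v k (I.1 l)).det : ℝ) := rfl

theorem coordForm_stdVec {n p : ℕ} (I J : IncTuple n p) :
    coordForm I (fun k => stdVec (J.1 k)) = if J = I then 1 else 0 := by
  rw [coordForm_apply]
  split_ifs with h
  · subst h
    have : (Matrix.of fun k l => (stdVec (J.1 k) : Euc n) (J.1 l)) = (1 : Matrix (Fin p) (Fin p) ℝ) := by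
      ext k l
      simp [Matrix.one_apply, J.2.injective.eq_iff, eq_comm]
    rw [this, Matrix.det_one, Complex.ofReal_one]
  · have hr : ¬ Set.range J.1 ⊆ Set.range I.1 := fun hs => h <| Subtype.ext <| by
      have h1 : Finset.univ.image J.1 = Finset.univ.image I.1 := by
        apply Finset.eq_of_subset_of_card_le
        · intro x hx
          simpa using hs (by simpa using hx)
        · simp [Finset.card_image_of_injective _ J.2.injective,
            Finset.card_image_of_injective _ I.2.injective]
      refine (J.2.range_inj I.2).mp ?_
      simpa using congrArg (fun s : Finset (Fin n) => (s : Set (Fin n))) h1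
    obtain ⟨_, ⟨k, rfl⟩, hk⟩ := Set.not_subset.mp hr
    rw [Matrix.det_eq_zero_of_row_eq_zero k, Complex.ofReal_zero]
    intro l
    have : J.1 k ≠ I.1 l := fun h => hk ⟨l, h.symm⟩
    simp [this.symm]

/-- A `p`-form is determined by its values on the increasing tuples of standard basis vectors. -/
theorem form_ext {n p : ℕ} {η θ : (Euc n) [⋀^Fin p]→L[ℝ] ℂ}
    (h : ∀ I : IncTuple n p, η (fun k => stdVec (I.1 k)) = θ (fun k => stdVec (I.1 k))) : η = θ := by
  apply ContinuousAlternatingMap.toAlternatingMap_injective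
  refine Module.Basis.ext_alternating (EuclideanSpace.basisFun (Fin n) ℝ).toBasis fun v hv => ?_
  have hs : StrictMono (v ∘ Tuple.sort v) :=
    (Tuple.monotone_sort v).strictMono_of_injective (hv.comp (Tuple.sort v).injective)
  have h1 := h ⟨v ∘ Tuple.sort v, hs⟩
  have h2 : ∀ ζ : (Euc n) [⋀^Fin p]→L[ℝ] ℂ, ζ (fun k => stdVec ((v ∘ Tuple.sort v) k)) =
      Equiv.Perm.sign (Tuple.sort v) • ζ (fun k => stdVec (v k)) := fun ζ =>
    ζ.toAlternatingMap.map_perm (fun k => stdVec (v k)) (Tuple.sort v)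
  rw [h2, h2] at h1
  have h3 := smul_left_cancel _ h1
  simpa using h3

/-- The basis of the complex vector space of `p`-forms that consists of the `dx_I`. -/
def formBasis (n p : ℕ) : Module.Basis (IncTuple n p) ℂ ((Euc n) [⋀^Fin p]→L[ℝ] ℂ) :=
  .ofEquivFun
    { toFun := fun η I => η (fun k => stdVec (I.1 k))
      map_add' := fun _ _ => rfl
      map_smul' := fun _ _ => rfl
      invFun := fun c => ∑ I, c I • coordForm I
      left_inv := fun η => form_ext fun I => by
        simp [ContinuousAlternatingMap.sum_apply, coordForm_stdVec]
      right_inv := fun c => by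
        funext I
        simp [ContinuousAlternatingMap.sum_apply, coordForm_stdVec] }

theorem formBasis_repr {n p : ℕ} (η : (Euc n) [⋀^Fin p]→L[ℝ] ℂ) (I : IncTuple n p) :
    (formBasis n p).repr η I = η (fun k => stdVec (I.1 k)) := rfl

theorem formBasis_apply {n p : ℕ} (I : IncTuple n p) : formBasis n p I = coordForm I := by
  apply (formBasis n p).repr.injective
  ext J
  rw [Module.Basis.repr_self, formBasis_repr, coordForm_stdVec, Finsupp.single_apply]
  simp [eq_comm]

instance (n p : ℕ) : FiniteDimensional ℂ ((Euc n) [⋀^Fin p]→L[ℝ] ℂ) :=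
  (formBasis n p).finiteDimensional_of_finite

/-- An integer matrix as a linear endomorphism of `ℝⁿ`. -/
def intMatCLM {n : ℕ} (R : Matrix (Fin n) (Fin n) ℤ) : Euc n →L[ℝ] Euc n :=
  Matrix.toEuclideanCLM (n := Fin n) (𝕜 := ℝ) (R.map (Int.cast : ℤ → ℝ))

theorem intMatCLM_apply {n : ℕ} (R : Matrix (Fin n) (Fin n) ℤ) (x : Euc n) (i : Fin n) :
    intMatCLM R x i = ∑ j, R i j * x j := rfl

theorem intMatCLM_mul {n : ℕ} (R S : Matrix (Fin n) (Fin n) ℤ) (x : Euc n) :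
    intMatCLM (R * S) x = intMatCLM R (intMatCLM S x) := by
  have : (R * S).map (Int.cast : ℤ → ℝ) = R.map Int.cast * S.map Int.cast :=
    Matrix.map_mul (f := Int.castRingHom ℝ)
  rw [intMatCLM, this, map_mul]
  rfl

theorem intMatCLM_one {n : ℕ} (x : Euc n) : intMatCLM 1 x = x := by
  have : (1 : Matrix (Fin n) (Fin n) ℤ).map (Int.cast : ℤ → ℝ) = 1 := by simp
  rw [intMatCLM, this, map_one]
  rfl

/-- Pulling back constant `p`-forms along a linear map. -/
def formPullback {n : ℕ} (p : ℕ) (L : Euc n →L[ℝ] Euc n) :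
    (Euc n) [⋀^Fin p]→L[ℝ] ℂ →ₗ[ℂ] (Euc n) [⋀^Fin p]→L[ℝ] ℂ where
  toFun η := η.compContinuousLinearMap L
  map_add' _ _ := rfl
  map_smul' _ _ := rfl

/-- The sum of the principal `p × p` minors of `R`: the trace of `R` on `p`-forms. -/
def minorTrace {n : ℕ} (p : ℕ) (R : Matrix (Fin n) (Fin n) ℤ) : ℤ :=
  ∑ I : IncTuple n p, (R.submatrix I.1 I.1).det

theorem trace_formPullback {n : ℕ} (p : ℕ) (R : Matrix (Fin n) (Fin n) ℤ) :
    LinearMap.trace ℂ _ (formPullback p (intMatCLM R)) = (minorTrace p R : ℂ) := by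
  rw [LinearMap.trace_eq_matrix_trace ℂ (formBasis n p), Matrix.trace, minorTrace, Int.cast_sum]
  refine Finset.sum_congr rfl fun I _ => ?_
  rw [Matrix.diag_apply, LinearMap.toMatrix_apply, formBasis_apply, formBasis_repr]
  show coordForm I (fun k => intMatCLM R (stdVec (I.1 k))) = _
  rw [coordForm_apply, ← Matrix.det_transpose]
  have : (Matrix.of fun k l => intMatCLM R (stdVec (I.1 k)) (I.1 l))ᵀ =
      ((R.submatrix I.1 I.1).map (Int.castRingHom ℝ)) := by
    ext k l
    simp [intMatCLM_apply]
  rw [this, ← RingHom.mapMatrix_apply, ← RingHom.map_det]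
  simp

/-! ### Crystallographic groups with given holonomy data -/

/-- Holonomy data for a crystallographic group with lattice `ℤⁿ`: a group `G` acting on `ℤⁿ` by
orthogonal integer matrices, and a cocycle `G → (¼ℤ)ⁿ` modulo `ℤⁿ`. The cocycle is stored as
`shift`, four times its values, so that it is a map to `ℤⁿ` satisfying the cocycle identity
modulo `4`. -/
structure HolonomyDatum (G : Type*) [Group G] (n : ℕ) where
  mat : G →* Matrix (Fin n) (Fin n) ℤ
  orthogonal : ∀ g, (mat g)ᵀ * mat g = 1
  shift : G → Fin n → ℤ
  cocycle : ∀ g h i, (4 : ℤ) ∣ shift g i + (mat g *ᵥ shift h) i - shift (g * h) i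

namespace HolonomyDatum

variable {G : Type*} [Group G] {n : ℕ} (D : HolonomyDatum G n)

/-- The isometry `γ` lies over `g` if it has the form `x ↦ R x + k / 4`, where `R` is the matrix of
`g` and `k` is congruent modulo `4` to the shift of `g`. -/
def LiesOver (γ : Isom n) (g : G) : Prop :=
  ∃ k : Fin n → ℤ, (∀ i, 4 ∣ k i - D.shift g i) ∧
    ∀ x i, γ x i = intMatCLM (D.mat g) x i + k i / 4

/-- The group `Γ` is an extension of `G` by `ℤⁿ` with holonomy data `D`. -/
structure Realizes (Γ : Subgroup (Isom n)) : Prop where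
  exists_liesOver : ∀ γ ∈ Γ, ∃ g, D.LiesOver γ g
  exists_mem : ∀ g, ∃ γ ∈ Γ, D.LiesOver γ g
  translation_mem : ∀ b ∈ canonicalLattice n, translation b ∈ Γ

theorem four_dvd_shift_one (i : Fin n) : 4 ∣ D.shift 1 i := by
  simpa using D.cocycle 1 1 i

theorem four_dvd_mulVec {R : Matrix (Fin n) (Fin n) ℤ} {k l : Fin n → ℤ}
    (h : ∀ i, 4 ∣ k i - l i) (i : Fin n) : 4 ∣ (R *ᵥ k) i - (R *ᵥ l) i := by
  rw [← Pi.sub_apply, ← Matrix.mulVec_sub]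
  show 4 ∣ ∑ j, R i j * (k - l) j
  exact Finset.dvd_sum fun j _ => Dvd.dvd.mul_left (h j) (R i j)

theorem intMatCLM_add_shift {R : Matrix (Fin n) (Fin n) ℤ} {x y : Euc n} {k : Fin n → ℤ}
    (h : ∀ j, y j = x j + k j / 4) (i : Fin n) :
    intMatCLM R y i = intMatCLM R x i + ((R *ᵥ k) i : ℤ) / 4 := by
  simp only [intMatCLM_apply, h, Matrix.mulVec, dotProduct]
  push_cast
  rw [Finset.sum_div, ← Finset.sum_add_distrib]
  exact Finset.sum_congr rfl fun j _ => by ring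

theorem isom_mul_apply (γ δ : Isom n) (x : Euc n) : (γ * δ) x = γ (δ x) := rfl

variable {D}

theorem LiesOver.mul {γ δ : Isom n} {g h : G} (hγ : D.LiesOver γ g) (hδ : D.LiesOver δ h) :
    D.LiesOver (γ * δ) (g * h) := by
  obtain ⟨k, hk, hγ⟩ := hγ
  obtain ⟨l, hl, hδ⟩ := hδ
  refine ⟨k + D.mat g *ᵥ l, fun i => ?_, fun x i => ?_⟩
  · have h1 := hk i
    have h2 := four_dvd_mulVec (R := D.mat g) hl i
    have h3 := D.cocycle g h i
    simp only [Pi.add_apply]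
    omega
  · rw [isom_mul_apply, hγ, intMatCLM_add_shift (hδ x), map_mul, intMatCLM_mul,
      Pi.add_apply]
    push_cast
    ring

theorem LiesOver.inv {γ : Isom n} {g : G} (hγ : D.LiesOver γ g) : D.LiesOver γ⁻¹ g⁻¹ := by
  obtain ⟨k, hk, hγ⟩ := hγ
  refine ⟨-(D.mat g⁻¹ *ᵥ k), fun i => ?_, fun x i => ?_⟩
  · have h2 := four_dvd_mulVec (R := D.mat g⁻¹) hk i
    have h3 := D.cocycle g⁻¹ g i
    have h4 := D.four_dvd_shift_one i
    rw [inv_mul_cancel] at h3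
    simp only [Pi.neg_apply]
    omega
  · have h1 : γ (γ⁻¹ x) = x := γ.apply_symm_apply x
    have h2 := intMatCLM_add_shift (R := D.mat g⁻¹) (hγ (γ⁻¹ x)) i
    rw [← intMatCLM_mul, ← map_mul, inv_mul_cancel, map_one, intMatCLM_one, h1] at h2
    rw [h2, Pi.neg_apply]
    push_cast
    ring

theorem translation_apply (b x : Euc n) : translation b x = x + b := add_comm b x

theorem translation_zero : translation (0 : Euc n) = 1 := by
  ext x i
  simp [translation_apply]

theorem liesOver_translation {b : Euc n} (hb : b ∈ canonicalLattice n) :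
    D.LiesOver (translation b) 1 := by
  choose m hm using hb
  refine ⟨fun i => 4 * m i, fun i => ?_, fun x i => ?_⟩
  · exact dvd_sub (dvd_mul_right _ _) (D.four_dvd_shift_one i)
  · rw [translation_apply, map_one, intMatCLM_one, PiLp.add_apply, hm]
    push_cast
    ring

theorem LiesOver.exists_eq_translation {γ : Isom n} (hγ : D.LiesOver γ 1) :
    ∃ b ∈ canonicalLattice n, γ = translation b := by
  obtain ⟨k, hk, hγ⟩ := hγ
  have h4 : ∀ i, ∃ m, k i = 4 * m := fun i => by
    have h1 := hk i
    have h2 := D.four_dvd_shift_one i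
    have : (4 : ℤ) ∣ k i := by omega
    exact this
  choose m hm using h4
  refine ⟨WithLp.toLp 2 fun i => (m i : ℝ), fun i => ⟨m i, rfl⟩, ?_⟩
  ext x i
  rw [hγ, translation_apply, map_one, intMatCLM_one, PiLp.add_apply, hm]
  push_cast
  simp

theorem LiesOver.linearPart_apply {γ : Isom n} {g : G} (hγ : D.LiesOver γ g) (v : Euc n) :
    linearPart n γ v = intMatCLM (D.mat g) v := by
  obtain ⟨k, -, hγ⟩ := hγ
  have h1 : γ v = linearPart n γ v + γ 0 := by
    have h := γ.map_vadd (0 : Euc n) v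
    rwa [vadd_eq_add, add_zero] at h
  ext i
  have h2 := congrArg (fun y : Euc n => y i) h1
  simp only [PiLp.add_apply, hγ, map_zero, PiLp.zero_apply, zero_add] at h2
  linarith

theorem intMatCLM_injective : Function.Injective (intMatCLM (n := n)) := by
  intro R S h
  ext i j
  have := congrArg (fun L : Euc n →L[ℝ] Euc n => L (stdVec j) i) h
  simpa [intMatCLM_apply] using this

theorem LiesOver.unique (hinj : Function.Injective D.mat) {γ : Isom n} {g h : G}
    (hg : D.LiesOver γ g) (hh : D.LiesOver γ h) : g = h := by
  apply hinj
  apply intMatCLM_injective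
  ext1 v
  rw [← hg.linearPart_apply, ← hh.linearPart_apply]

/-! ### Bieberbach groups from holonomy data -/

variable {Γ : Subgroup (Isom n)}

theorem Realizes.discrete (hΓ : D.Realizes Γ) :
    IsDiscrete (toContinuousMap '' (Γ : Set (Isom n))) := by
  rw [isDiscrete_iff_forall_mem_exists_isOpen]
  rintro _ ⟨γ, hγ, rfl⟩
  let pt : Option (Fin n) → Euc n := fun o => o.elim 0 stdVec
  -- Elements of `Γ` map the points `pt o` of the lattice into `(¼ℤ)ⁿ`, so they are separated by
  -- their values there.
  refine ⟨⋂ o, {f | dist (f (pt o)) (γ (pt o)) < 1 / 4}, isOpen_iInter_of_finite fun o =>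
    isOpen_lt (by fun_prop) continuous_const, ?_⟩
  ext f
  simp only [Set.mem_inter_iff, Set.mem_iInter, Set.mem_ofPred_eq, Set.mem_singleton_iff]
  constructor
  · rintro ⟨hf, δ, hδ, rfl⟩
    obtain ⟨g, k, -, hg⟩ := hΓ.exists_liesOver γ hγ
    obtain ⟨h, l, -, hh⟩ := hΓ.exists_liesOver δ hδ
    have hint : ∀ a b : ℤ, |(a - b : ℝ) / 4| < 1 / 4 → a = b := fun a b hab => by
      rw [abs_div, abs_of_pos (by norm_num : (0 : ℝ) < 4), div_lt_div_iff_of_pos_right (by norm_num)]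
        at hab
      have h1 : |a - b| < 1 := by exact_mod_cast hab
      rw [Int.abs_lt_one_iff] at h1
      omega
    have hcoord : ∀ o i, |δ (pt o) i - γ (pt o) i| < 1 / 4 := fun o i => by
      have h1 : ‖δ (pt o) - γ (pt o)‖ < 1 / 4 := by
        rw [← dist_eq_norm]
        exact hf o
      exact (PiLp.norm_apply_le (δ (pt o) - γ (pt o)) i).trans_lt h1
    have hkl : ∀ i, l i = k i := fun i => by
      apply hint
      have h1 := hcoord none i
      rw [hg, hh] at h1
      convert h1 using 2
      simp [pt]
      ring
    have hmat : D.mat h = D.mat g := by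
      ext i j
      have h1 := hcoord (some j) i
      rw [hg, hh, hkl] at h1
      have h2 : 4 * D.mat h i j = 4 * D.mat g i j := by
        apply hint
        convert h1 using 2
        simp [pt, intMatCLM_apply]
        ring
      omega
    ext x i
    show δ x i = γ x i
    rw [hg, hh, hkl, hmat]
  · rintro rfl
    exact ⟨fun o => by simp [toContinuousMap], γ, hγ, rfl⟩

theorem Realizes.cocompact (hΓ : D.Realizes Γ) :
    ∃ K : Set (Euc n), IsCompact K ∧ ∀ x, ∃ γ ∈ Γ, γ x ∈ K := by
  refine ⟨WithLp.toLp 2 '' Set.Icc 0 1, isCompact_Icc.image (PiLp.continuous_toLp 2 _), fun x => ?_⟩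
  refine ⟨translation (WithLp.toLp 2 fun i => ((-⌊x i⌋ : ℤ) : ℝ)),
    hΓ.translation_mem _ fun i => ⟨_, rfl⟩, fun i => Int.fract (x i),
    ⟨fun i => Int.fract_nonneg _, fun i => (Int.fract_lt_one _).le⟩, ?_⟩
  ext i
  simp [translation_apply, Int.fract, sub_eq_add_neg]

/-- A covector fixed by the linear part of `γ` measures how far the powers of `γ` move a point. -/
theorem fixed_covector_pow {γ : Isom n} {R : Matrix (Fin n) (Fin n) ℤ} {k w : Fin n → ℤ}
    (hγ : ∀ x i, γ x i = intMatCLM R x i + k i / 4) (hw : w ᵥ* R = w) (N : ℕ) (x : Euc n) :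
    ∑ i, w i * (γ ^ N) x i = ∑ i, w i * x i + N * ((w ⬝ᵥ k : ℤ) / 4 : ℝ) := by
  induction N with
  | zero => simp
  | succ N ih =>
    rw [pow_succ', isom_mul_apply]
    have h1 : ∀ y : Euc n, ∑ i, (w i : ℝ) * intMatCLM R y i = ∑ i, w i * y i := fun y => by
      simp only [intMatCLM_apply, Finset.mul_sum]
      rw [Finset.sum_comm]
      refine Finset.sum_congr rfl fun j _ => ?_
      have : ((w ᵥ* R) j : ℝ) = w j := by rw [hw]
      rw [← this]
      simp [vecMul, dotProduct, Finset.sum_mul, mul_assoc]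
    simp only [hγ, mul_add, Finset.sum_add_distrib, h1, ih]
    have h2 : ∑ i, (w i : ℝ) * (k i / 4) = (w ⬝ᵥ k : ℤ) / 4 := by
      simp [dotProduct, Finset.sum_div, mul_div_assoc]
    rw [h2]
    push_cast
    ring

/-- If every nontrivial `g` has a fixed covector whose pairing with the translation part over `g` is
not an integer, then no isometry over `g` has finite order, and neither has a nonzero translation. -/
theorem Realizes.torsionFree (hΓ : D.Realizes Γ)
    (hD : ∀ g ≠ 1, ∃ w, w ᵥ* D.mat g = w ∧ ¬ 4 ∣ w ⬝ᵥ D.shift g) :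
    ∀ γ ∈ Γ, IsOfFinOrder γ → γ = 1 := by
  intro γ hγ hfin
  obtain ⟨g, k, hk, hform⟩ := hΓ.exists_liesOver γ hγ
  obtain ⟨N, hN, hpow⟩ := hfin.exists_pow_eq_one
  have key : ∀ w, w ᵥ* D.mat g = w → w ⬝ᵥ k = 0 := by
    intro w hw
    have h1 := fixed_covector_pow hform hw N 0
    rw [hpow] at h1
    have hN' : (N : ℝ) ≠ 0 := by exact_mod_cast hN.ne'
    have h2 : (N : ℝ) * ((w ⬝ᵥ k : ℤ) / 4 : ℝ) = 0 := by simpa using h1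
    have h3 : ((w ⬝ᵥ k : ℤ) : ℝ) = 0 := by
      rcases mul_eq_zero.mp h2 with h | h
      · exact absurd h hN'
      · linarith
    exact_mod_cast h3
  by_cases hg : g = 1
  · subst hg
    have hk0 : ∀ i, k i = 0 := fun i => by
      simpa using key (Pi.single i 1) (by simp)
    ext x i
    rw [hform, hk0, map_one, intMatCLM_one]
    simp
  · obtain ⟨w, hw, hdvd⟩ := hD g hg
    refine absurd ?_ hdvd
    have h1 : 4 ∣ w ⬝ᵥ (k - D.shift g) := Finset.dvd_sum fun i _ => Dvd.dvd.mul_left (hk i) (w i)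
    rwa [dotProduct_sub, key w hw, zero_sub, Int.dvd_neg] at h1

theorem Realizes.isBieberbach (hΓ : D.Realizes Γ)
    (hD : ∀ g ≠ 1, ∃ w, w ᵥ* D.mat g = w ∧ ¬ 4 ∣ w ⬝ᵥ D.shift g) : IsBieberbach Γ :=
  ⟨hΓ.discrete, hΓ.cocompact, hΓ.torsionFree hD⟩

theorem Realizes.hasCanonicalLattice (hΓ : D.Realizes Γ) (hinj : Function.Injective D.mat) :
    HasCanonicalLattice Γ := by
  intro b
  refine ⟨fun hb => ?_, hΓ.translation_mem b⟩
  obtain ⟨g, hg⟩ := hΓ.exists_liesOver _ hb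
  have h1 : g = 1 := by
    apply hinj
    apply intMatCLM_injective
    ext1 v
    rw [← hg.linearPart_apply, map_one, intMatCLM_one]
    rfl
  subst h1
  obtain ⟨c, hc, hbc⟩ := hg.exists_eq_translation
  have : b = c := by
    simpa [translation_apply] using congrArg (fun γ : Isom n => γ 0) hbc
  exact this ▸ hc

theorem Realizes.nonempty_holonomy_mulEquiv (hΓ : D.Realizes Γ)
    (hinj : Function.Injective D.mat) : Nonempty (Holonomy Γ ≃* G) := by
  choose q hq using fun γ : Γ => hΓ.exists_liesOver γ.1 γ.2
  let f : Γ →* G := MonoidHom.mk' q fun γ δ =>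
    (hq (γ * δ)).unique hinj ((hq γ).mul (hq δ))
  have hsurj : Function.Surjective f := fun g => by
    obtain ⟨γ, hγ, hg⟩ := hΓ.exists_mem g
    exact ⟨⟨γ, hγ⟩, (hq _).unique hinj hg⟩
  have hker : translations Γ = f.ker := by
    ext γ
    rw [MonoidHom.mem_ker]
    show linearPart n γ.1 = 1 ↔ q γ = 1
    have h1 := (hq γ).linearPart_apply
    constructor
    · intro h
      apply hinj
      apply intMatCLM_injective
      ext1 v
      rw [← h1, h, map_one, intMatCLM_one]
      rfl
    · intro h
      ext1 v
      rw [h1, h, map_one, intMatCLM_one]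
      rfl
  exact ⟨(QuotientGroup.quotientMulEquivOfEq hker).trans
    (QuotientGroup.quotientKerEquivOfSurjective f hsurj)⟩

/-- A group generated by `ℤⁿ` and isometries lying over generators of `G` realizes its holonomy
data. -/
theorem realizes_closure (D : HolonomyDatum G n) {X : Set (Isom n)} {Y : Set G} (hY : Subgroup.closure Y = ⊤)
    (hX : ∀ γ ∈ X, ∃ g, D.LiesOver γ g) (hXY : ∀ g ∈ Y, ∃ γ ∈ X, D.LiesOver γ g) :
    D.Realizes (Subgroup.closure (X ∪ translation '' canonicalLattice n)) where
  exists_liesOver γ hγ := by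
    induction hγ using Subgroup.closure_induction with
    | mem γ hγ =>
      rcases hγ with hγ | ⟨b, hb, rfl⟩
      · exact hX γ hγ
      · exact ⟨1, liesOver_translation hb⟩
    | one => exact ⟨1, translation_zero (n := n) ▸ liesOver_translation fun _ => ⟨0, by simp⟩⟩
    | mul γ δ _ _ hγ hδ =>
      obtain ⟨g, hg⟩ := hγ
      obtain ⟨h, hh⟩ := hδ
      exact ⟨g * h, hg.mul hh⟩
    | inv γ _ hγ =>
      obtain ⟨g, hg⟩ := hγ
      exact ⟨g⁻¹, hg.inv⟩
  exists_mem g := by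
    have hg : g ∈ Subgroup.closure Y := hY ▸ Subgroup.mem_top g
    induction hg using Subgroup.closure_induction with
    | mem g hg =>
      obtain ⟨γ, hγ, h⟩ := hXY g hg
      exact ⟨γ, Subgroup.subset_closure (Or.inl hγ), h⟩
    | one => exact ⟨translation 0, Subgroup.subset_closure (Or.inr ⟨0, fun _ => ⟨0, by simp⟩, rfl⟩),
        liesOver_translation fun _ => ⟨0, by simp⟩⟩
    | mul g h _ _ hg hh =>
      obtain ⟨γ, hγ, hg⟩ := hg
      obtain ⟨δ, hδ, hh⟩ := hh
      exact ⟨γ * δ, mul_mem hγ hδ, hg.mul hh⟩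
    | inv g _ hg =>
      obtain ⟨γ, hγ, hg⟩ := hg
      exact ⟨γ⁻¹, inv_mem hγ, hg.inv⟩
  translation_mem b hb := Subgroup.subset_closure (Or.inr ⟨b, hb, rfl⟩)

end HolonomyDatum

/-! ### Trigonometric polynomials -/

section Trig

variable {n : ℕ} {lam : ℝ} {F : Type*} [NormedAddCommGroup F] [NormedSpace ℂ F]

/-- The trigonometric polynomial `∑ exp (2πi v·x) a_v`, with frequencies `v` belonging to the
eigenvalue `lam` and coefficients in `F`. -/
def trigPoly (n : ℕ) (lam : ℝ) (F : Type*) [NormedAddCommGroup F] [NormedSpace ℂ F] :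
    (frequencies n lam → F) →ₗ[ℂ] (Euc n → F) where
  toFun a x := ∑ v, expChar v.1 x • a v
  map_add' a b := by
    funext x
    simp [smul_add, Finset.sum_add_distrib]
  map_smul' c a := by
    funext x
    simp [Finset.smul_sum, smul_comm c]

theorem trigPoly_apply (a : frequencies n lam → F) (x : Euc n) :
    trigPoly n lam F a x = ∑ v, expChar v.1 x • a v := rfl

/-- The linear functional `x ↦ 2πi v·x`. -/
def phaseCLM (v : Fin n → ℤ) : Euc n →L[ℝ] ℂ :=
  ∑ i, (EuclideanSpace.proj i : Euc n →L[ℝ] ℝ).smulRight (2 * Real.pi * Complex.I * v i)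

theorem phaseCLM_apply (v : Fin n → ℤ) (x : Euc n) :
    phaseCLM v x = 2 * Real.pi * Complex.I * ((∑ i, v i * x i : ℝ) : ℂ) := by
  simp only [phaseCLM, _root_.sum_apply, ContinuousLinearMap.smulRight_apply,
    Complex.real_smul]
  push_cast
  rw [Finset.mul_sum]
  refine Finset.sum_congr rfl fun i _ => ?_
  show (x i : ℂ) * _ = _
  ring

theorem expChar_eq (v : Fin n → ℤ) : expChar v = fun x => Complex.exp (phaseCLM v x) := by
  funext x
  rw [phaseCLM_apply, expChar]

theorem phaseCLM_stdVec (v : Fin n → ℤ) (j : Fin n) :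
    phaseCLM v (stdVec j) = 2 * Real.pi * Complex.I * v j := by
  rw [phaseCLM_apply]
  congr 1
  norm_cast
  simp

theorem contDiff_expChar (v : Fin n → ℤ) : ContDiff ℝ ∞ (expChar v) := by
  rw [expChar_eq]
  exact (phaseCLM v).contDiff.cexp

theorem hasFDerivAt_expChar (v : Fin n → ℤ) (x : Euc n) :
    HasFDerivAt (expChar v) (expChar v x • phaseCLM v) x := by
  rw [expChar_eq]
  exact (phaseCLM v).hasFDerivAt.cexp

variable [NormedSpace ℝ F] [IsScalarTower ℝ ℂ F]

theorem contDiff_trigPoly (a : frequencies n lam → F) : ContDiff ℝ ∞ (trigPoly n lam F a) :=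
  ContDiff.sum fun v _ => (contDiff_expChar v.1).smul contDiff_const

theorem fderiv_trigPoly (a : frequencies n lam → F) (x : Euc n) (j : Fin n) :
    fderiv ℝ (trigPoly n lam F a) x (stdVec j) =
      trigPoly n lam F (fun v => (2 * Real.pi * Complex.I * v.1 j) • a v) x := by
  have h : HasFDerivAt (trigPoly n lam F a)
      (∑ v, (expChar v.1 x • phaseCLM v.1).smulRight (a v)) x :=
    HasFDerivAt.fun_sum fun v _ => (hasFDerivAt_expChar v.1 x).smul_const (a v)
  rw [h.fderiv, trigPoly_apply, _root_.sum_apply]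
  refine Finset.sum_congr rfl fun v _ => ?_
  rw [ContinuousLinearMap.smulRight_apply, _root_.smul_apply, phaseCLM_stdVec,
    smul_eq_mul, mul_smul]

theorem laplacian_trigPoly (a : frequencies n lam → F) (x : Euc n) :
    -(Laplacian.laplacian (trigPoly n lam F a) : Euc n → F) x = lam • trigPoly n lam F a x := by
  rw [laplacian_eq_sum_partialDeriv (contDiff_trigPoly a)]
  have h1 : ∀ (a : frequencies n lam → F) (j : Fin n),
      (fun y => fderiv ℝ (trigPoly n lam F a) y (EuclideanSpace.single j 1)) =
      trigPoly n lam F (fun v => (2 * Real.pi * Complex.I * v.1 j) • a v) :=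
    fun a j => funext fun y => fderiv_trigPoly a y j
  simp only [h1]
  have h2 := fun j => congrFun (h1 (fun v => (2 * Real.pi * Complex.I * v.1 j) • a v) j) x
  simp only [h2, trigPoly_apply]
  rw [Finset.sum_comm, Finset.smul_sum, ← Finset.sum_neg_distrib]
  refine Finset.sum_congr rfl fun v _ => ?_
  rw [← Finset.smul_sum, smul_comm lam, ← smul_neg]
  congr 1
  simp only [smul_smul]
  rw [← Finset.sum_smul, ← neg_smul, ← algebraMap_smul ℂ lam (a v), Complex.coe_algebraMap]
  congr 1
  have h3 : (4 * Real.pi ^ 2 * ((∑ i, v.1 i ^ 2 : ℤ) : ℝ)) = lam := v.2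
  refine Eq.trans ?_ (congrArg Complex.ofReal h3)
  push_cast
  rw [Finset.mul_sum, ← Finset.sum_neg_distrib]
  refine Finset.sum_congr rfl fun j _ => ?_
  linear_combination (-4 * (Real.pi : ℂ) ^ 2 * (v.1 j : ℂ) ^ 2) * Complex.I_sq

end Trig

/-- Evaluation of a form on fixed vectors, as a continuous linear functional. -/
def evalForm {n p : ℕ} (v : Fin p → Euc n) : ((Euc n) [⋀^Fin p]→L[ℝ] ℂ) →L[ℝ] ℂ :=
  ContinuousAlternatingMap.apply ℝ (Euc n) ℂ v

theorem trigPoly_injective {n p : ℕ} {lam : ℝ} :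
    Function.Injective (trigPoly n lam ((Euc n) [⋀^Fin p]→L[ℝ] ℂ)) := by
  rw [injective_iff_map_eq_zero]
  intro a ha
  funext v
  refine form_ext fun I => ?_
  have h1 := (linearIndependent_expChar (n := n)).comp (fun v : frequencies n lam => v.1)
    Subtype.val_injective
  rw [Fintype.linearIndependent_iff] at h1
  refine h1 (fun v => a v fun k => stdVec (I.1 k)) ?_ v
  funext x
  have h2 := congrArg (fun η : (Euc n) [⋀^Fin p]→L[ℝ] ℂ => η fun k => stdVec (I.1 k))
    (congrFun ha x)
  rw [trigPoly_apply] at h2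
  simpa [ContinuousAlternatingMap.sum_apply, mul_comm] using h2

/-- A smooth periodic `p`-form which is an eigenform for `lam` is a trigonometric polynomial. -/
theorem exists_trigPoly_eq {n p : ℕ} {lam : ℝ} {η : Form n p} (hη : ContDiff ℝ ∞ η)
    (hp : IsPeriodic η) (hlam : ∀ x, -(Laplacian.laplacian η : Form n p) x = lam • η x) :
    ∃ a, trigPoly n lam _ a = η := by
  have h : ∀ I : IncTuple n p, ∃ c : frequencies n lam → ℂ,
      ∀ x, η x (fun k => stdVec (I.1 k)) = ∑ v, expChar v.1 x * c v := by
    intro I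
    have hs : ContDiff ℝ ∞ (evalForm (fun k => stdVec (I.1 k)) ∘ η) :=
      (evalForm _).contDiff.comp hη
    refine exists_eq_sum_expChar hs (fun b hb x => ?_) fun x => ?_
    · show evalForm _ (η (x + b)) = evalForm _ (η x)
      rw [hp b hb x]
    · change -(Laplacian.laplacian (evalForm (fun k => stdVec (I.1 k)) ∘ η) : Euc n → ℂ) x = _
      rw [(hη.contDiffAt.of_le ENat.LEInfty.out).laplacian_CLM_comp_left]
      have := congrArg (evalForm (fun k => stdVec (I.1 k))) (hlam x)
      rwa [map_neg, map_smul] at this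
  choose c hc using h
  refine ⟨fun v => ∑ I, c I v • coordForm I, ?_⟩
  funext x
  refine form_ext fun I => ?_
  rw [hc, trigPoly_apply]
  simp [ContinuousAlternatingMap.sum_apply, coordForm_stdVec]

/-- The trace of an operator on vectors of elements of `A` which permutes the entries and applies
multiples of a fixed operator of `A` to them. -/
theorem trace_monomial {ι A : Type*} [Fintype ι] [DecidableEq ι] [AddCommGroup A] [Module ℂ A]
    [FiniteDimensional ℂ A] (π : ι → ι) (c : ι → ℂ) (L : A →ₗ[ℂ] A)
    (T : (ι → A) →ₗ[ℂ] (ι → A)) (hT : ∀ a w, T a w = c w • L (a (π w))) :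
    LinearMap.trace ℂ _ T = (∑ w, if π w = w then c w else 0) * LinearMap.trace ℂ _ L := by
  let b := Module.finBasis ℂ A
  rw [LinearMap.trace_eq_matrix_trace ℂ (Pi.basis fun _ : ι => b),
    LinearMap.trace_eq_matrix_trace ℂ b, Matrix.trace, Matrix.trace, Fintype.sum_sigma,
    Finset.sum_mul]
  refine Finset.sum_congr rfl fun w _ => ?_
  rw [Finset.mul_sum]
  refine Finset.sum_congr rfl fun j _ => ?_
  simp only [Matrix.diag_apply, LinearMap.toMatrix_apply, Pi.basis_apply, Pi.basis_repr, hT]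
  split_ifs with h
  · rw [h]; simp
  · rw [Pi.single_eq_of_ne h]; simp

/-! ### The holonomy representation on Fourier coefficients -/

namespace HolonomyDatum

variable {G : Type*} [Group G] {n : ℕ} (D : HolonomyDatum G n) (p : ℕ) (lam : ℝ)

theorem I_zpow_congr {a b : ℤ} (h : 4 ∣ a - b) : Complex.I ^ a = Complex.I ^ b := by
  obtain ⟨c, hc⟩ := h
  obtain rfl : a = b + 4 * c := by omega
  rw [zpow_add₀ Complex.I_ne_zero, _root_.zpow_mul, show (4 : ℤ) = (4 : ℕ) from rfl, zpow_natCast,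
    Complex.I_pow_four, _root_.one_zpow, mul_one]

theorem I_zpow_eq_exp (m : ℤ) :
    Complex.I ^ m = Complex.exp (2 * Real.pi * Complex.I * ((m / 4 : ℝ) : ℂ)) := by
  conv_lhs => rw [← Complex.exp_pi_div_two_mul_I, ← Complex.exp_int_mul]
  congr 1
  push_cast
  ring

theorem mulVec_dotProduct_mulVec (g : G) (v w : Fin n → ℤ) :
    (D.mat g *ᵥ v) ⬝ᵥ (D.mat g *ᵥ w) = v ⬝ᵥ w := by
  rw [Matrix.dotProduct_mulVec, Matrix.vecMul_mulVec, D.orthogonal, Matrix.vecMul_one]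

/-- The action of `G` on the frequencies belonging to an eigenvalue. -/
def freqAct (g : G) (v : frequencies n lam) : frequencies n lam :=
  ⟨D.mat g *ᵥ v.1, by
    have h1 : ∑ i, (D.mat g *ᵥ v.1) i ^ 2 = ∑ i, v.1 i ^ 2 := by
      simpa [dotProduct, sq] using D.mulVec_dotProduct_mulVec g v.1 v.1
    show 4 * Real.pi ^ 2 * ((∑ i, (D.mat g *ᵥ v.1) i ^ 2 : ℤ) : ℝ) = lam
    rw [h1]
    exact v.2⟩

theorem freqAct_mul (g h : G) (v : frequencies n lam) :
    D.freqAct lam (g * h) v = D.freqAct lam g (D.freqAct lam h v) :=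
  Subtype.ext <| by simp [freqAct, Matrix.mulVec_mulVec]

theorem freqAct_one (v : frequencies n lam) : D.freqAct lam 1 v = v :=
  Subtype.ext <| by simp [freqAct]

/-- The pullback along an isometry lying over `g`, on the coefficients of trigonometric
polynomials. The isometry turns the frequency `R w` into `w` and multiplies by the phase
`exp (2πi (R w)·k / 4) = i ^ ((R w)·k)`. -/
def coeffPullback (g : G) :
    (frequencies n lam → (Euc n) [⋀^Fin p]→L[ℝ] ℂ) →ₗ[ℂ]
      (frequencies n lam → (Euc n) [⋀^Fin p]→L[ℝ] ℂ) where
  toFun a w := Complex.I ^ ((D.freqAct lam g w).1 ⬝ᵥ D.shift g) •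
    formPullback p (intMatCLM (D.mat g)) (a (D.freqAct lam g w))
  map_add' a b := by
    funext w
    simp
  map_smul' c a := by
    funext w
    simp [smul_comm c]

theorem coeffPullback_apply (g : G) (a : frequencies n lam → (Euc n) [⋀^Fin p]→L[ℝ] ℂ)
    (w : frequencies n lam) :
    D.coeffPullback p lam g a w = Complex.I ^ ((D.freqAct lam g w).1 ⬝ᵥ D.shift g) •
      formPullback p (intMatCLM (D.mat g)) (a (D.freqAct lam g w)) := rfl

theorem formPullback_mul (R S : Matrix (Fin n) (Fin n) ℤ) (η : (Euc n) [⋀^Fin p]→L[ℝ] ℂ) :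
    formPullback p (intMatCLM (R * S)) η =
      formPullback p (intMatCLM S) (formPullback p (intMatCLM R) η) := by
  ext v
  show η _ = η _
  congr 1
  funext k
  exact intMatCLM_mul R S (v k)

theorem formPullback_one (η : (Euc n) [⋀^Fin p]→L[ℝ] ℂ) :
    formPullback p (intMatCLM 1) η = η := by
  ext v
  show η _ = η _
  congr 1
  funext k
  exact intMatCLM_one (v k)

theorem coeffPullback_mul (g h : G) :
    D.coeffPullback p lam (g * h) = D.coeffPullback p lam h ∘ₗ D.coeffPullback p lam g := by
  refine LinearMap.ext fun a => funext fun w => ?_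
  rw [LinearMap.comp_apply, coeffPullback_apply, coeffPullback_apply, coeffPullback_apply,
    map_smul, smul_smul, ← freqAct_mul, map_mul, formPullback_mul, ← zpow_add₀ Complex.I_ne_zero]
  congr 1
  apply I_zpow_congr
  have h1 : (D.freqAct lam h w).1 ⬝ᵥ D.shift h =
      (D.freqAct lam (g * h) w).1 ⬝ᵥ (D.mat g *ᵥ D.shift h) := by
    rw [freqAct_mul]
    exact (D.mulVec_dotProduct_mulVec g _ _).symm
  have h2 : 4 ∣ (D.freqAct lam (g * h) w).1 ⬝ᵥ
      (D.shift g + D.mat g *ᵥ D.shift h - D.shift (g * h)) :=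
    Finset.dvd_sum fun i _ => Dvd.dvd.mul_left (D.cocycle g h i) _
  rw [dotProduct_sub, dotProduct_add] at h2
  rw [h1]
  omega

theorem coeffPullback_one : D.coeffPullback p lam 1 = LinearMap.id := by
  refine LinearMap.ext fun a => funext fun w => ?_
  have h1 : Complex.I ^ (w.1 ⬝ᵥ D.shift 1) = Complex.I ^ (0 : ℤ) := by
    apply I_zpow_congr
    rw [sub_zero]
    exact Finset.dvd_sum fun i _ => Dvd.dvd.mul_left (D.four_dvd_shift_one i) _
  rw [coeffPullback_apply, freqAct_one, h1, map_one, formPullback_one, zpow_zero, one_smul,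
    LinearMap.id_apply]

variable {D}

theorem expChar_of_liesOver {γ : Isom n} {g : G} (hγ : D.LiesOver γ g) (w : frequencies n lam)
    (x : Euc n) :
    expChar (D.freqAct lam g w).1 (γ x) =
      expChar w.1 x * Complex.I ^ ((D.freqAct lam g w).1 ⬝ᵥ D.shift g) := by
  obtain ⟨k, hk, hγ⟩ := hγ
  have h1 : Complex.I ^ ((D.freqAct lam g w).1 ⬝ᵥ D.shift g) =
      Complex.exp (2 * Real.pi * Complex.I * ((((D.freqAct lam g w).1 ⬝ᵥ k : ℤ) / 4 : ℝ) : ℂ)) := by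
    have h2 : 4 ∣ (D.freqAct lam g w).1 ⬝ᵥ (D.shift g - k) :=
      Finset.dvd_sum fun i _ => Dvd.dvd.mul_left ((dvd_sub_comm).mp (hk i)) _
    rw [dotProduct_sub] at h2
    rw [I_zpow_congr h2, I_zpow_eq_exp]
  have h3 : ∑ i, ((D.freqAct lam g w).1 i : ℝ) * intMatCLM (D.mat g) x i = ∑ i, w.1 i * x i := by
    have h4 : ∀ j, (((D.mat g *ᵥ w.1) ᵥ* D.mat g) j : ℤ) = w.1 j := fun j => by
      rw [Matrix.vecMul_mulVec, D.orthogonal, Matrix.vecMul_one]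
    simp only [intMatCLM_apply, Finset.mul_sum]
    rw [Finset.sum_comm]
    refine Finset.sum_congr rfl fun j _ => ?_
    rw [← h4 j]
    simp [vecMul, dotProduct, Finset.sum_mul, mul_assoc, freqAct]
  rw [h1, expChar, expChar, ← Complex.exp_add, ← mul_add, ← Complex.ofReal_add]
  congr 3
  rw [← h3]
  simp only [hγ, mul_add, Finset.sum_add_distrib]
  simp [dotProduct, Finset.sum_div, mul_div_assoc]

theorem pullback_trigPoly {γ : Isom n} {g : G} (hγ : D.LiesOver γ g)
    (a : frequencies n lam → (Euc n) [⋀^Fin p]→L[ℝ] ℂ) :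
    pullback γ (trigPoly n lam _ a : Form n p) =
      trigPoly n lam _ (D.coeffPullback p lam g a) := by
  funext x
  have h1 : pullback γ (trigPoly n lam _ a : Form n p) x =
      formPullback p (intMatCLM (D.mat g)) (trigPoly n lam _ a (γ x)) := by
    ext v
    show trigPoly n lam _ a (γ x) _ = trigPoly n lam _ a (γ x) _
    congr 1
    funext k
    exact hγ.linearPart_apply (v k)
  have hbij : Function.Bijective (D.freqAct lam g) :=
    Function.bijective_iff_has_inverse.mpr ⟨D.freqAct lam g⁻¹,
      fun v => by rw [← freqAct_mul, inv_mul_cancel, freqAct_one],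
      fun v => by rw [← freqAct_mul, mul_inv_cancel, freqAct_one]⟩
  rw [h1, trigPoly_apply, trigPoly_apply, map_sum]
  simp only [map_smul]
  rw [← hbij.sum_comp]
  refine Finset.sum_congr rfl fun w _ => ?_
  rw [coeffPullback_apply, expChar_of_liesOver lam hγ, mul_smul]

variable (D)

/-- The representation of the holonomy group on the coefficients of the trigonometric polynomials
belonging to an eigenvalue. Pullback reverses products, hence the inverse. -/
def coeffRep : Representation ℂ G (frequencies n lam → (Euc n) [⋀^Fin p]→L[ℝ] ℂ) where
  toFun g := D.coeffPullback p lam g⁻¹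
  map_one' := by
    rw [inv_one, coeffPullback_one]
    rfl
  map_mul' g h := by
    rw [_root_.mul_inv_rev, coeffPullback_mul]
    rfl

variable {D} {Γ : Subgroup (Isom n)}

/-- The eigenforms are the trigonometric polynomials with coefficients invariant under the holonomy
group. -/
theorem Realizes.eigenforms_eq (hΓ : D.Realizes Γ) :
    eigenforms Γ p lam = (D.coeffRep p lam).invariants.map (trigPoly n lam _) := by
  ext η
  constructor
  · rintro ⟨hs, hinv, hlam⟩
    have hper : IsPeriodic η := fun b hb x => by
      have h1 := congrFun (hinv _ (hΓ.translation_mem b hb)) x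
      rw [← translation_apply b x]
      exact h1
    obtain ⟨a, rfl⟩ := exists_trigPoly_eq hs hper hlam
    refine ⟨a, fun g => ?_, rfl⟩
    obtain ⟨γ, hγ, hg⟩ := hΓ.exists_mem g⁻¹
    apply trigPoly_injective
    show trigPoly n lam _ (D.coeffPullback p lam g⁻¹ a) = _
    rw [← pullback_trigPoly p lam hg]
    exact hinv γ hγ
  · rintro ⟨a, ha, rfl⟩
    refine ⟨contDiff_trigPoly a, fun γ hγ => ?_, laplacian_trigPoly a⟩
    obtain ⟨g, hg⟩ := hΓ.exists_liesOver γ hγ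
    rw [pullback_trigPoly p lam hg]
    congr 1
    have := ha g⁻¹
    change D.coeffPullback p lam g⁻¹⁻¹ a = a at this
    rwa [inv_inv] at this

theorem Realizes.eigenMultiplicity_eq (hΓ : D.Realizes Γ) :
    eigenMultiplicity Γ p lam = Module.finrank ℂ (D.coeffRep p lam).invariants := by
  rw [eigenMultiplicity, hΓ.eigenforms_eq, Module.finrank_eq_rank]
  exact (Submodule.equivMapOfInjective _ trigPoly_injective _).rank_eq.symm

variable (D)

/-- The real part of `i ^ k`. -/
def quarterCos (k : ℤ) : ℤ := if k % 4 = 0 then 1 else if k % 4 = 2 then -1 else 0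

theorem re_I_zpow (k : ℤ) : (Complex.I ^ k).re = quarterCos k := by
  have h1 : Complex.I ^ k = Complex.I ^ (k % 4) := I_zpow_congr (by omega)
  rw [h1, quarterCos]
  have h2 : k % 4 = 0 ∨ k % 4 = 1 ∨ k % 4 = 2 ∨ k % 4 = 3 := by omega
  rcases h2 with h | h | h | h <;> rw [h]
  · simp
  · simp
  · norm_num [zpow_ofNat]
  · norm_num [zpow_ofNat, pow_succ]

/-- The sum of `cos (2π w·k / 4)`, with `k` the shift of `g`, over the frequencies `w` fixed by `g`.
Times the trace of `g` on `p`-forms, it is the real part of the trace of `g` on the coefficients. -/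
def fixedSum (g : G) : ℤ :=
  ∑ w : frequencies n lam, if D.mat g *ᵥ w.1 = w.1 then quarterCos (w.1 ⬝ᵥ D.shift g) else 0

/-- Real parts suffice to compute the multiplicity, and they are integers. -/
theorem re_trace_coeffPullback (g : G) :
    (LinearMap.trace ℂ _ (D.coeffPullback p lam g)).re =
      (minorTrace p (D.mat g) * D.fixedSum lam g : ℤ) := by
  classical
  rw [trace_monomial (D.freqAct lam g) _ _ _ (D.coeffPullback_apply p lam g), trace_formPullback,
    mul_comm, ← Complex.ofReal_intCast, Complex.re_ofReal_mul, Complex.re_sum, Int.cast_mul,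
    fixedSum, Int.cast_sum]
  congr 1
  refine Finset.sum_congr rfl fun w _ => ?_
  have h1 : D.freqAct lam g w = w ↔ D.mat g *ᵥ w.1 = w.1 := Subtype.ext_iff
  by_cases h : D.freqAct lam g w = w
  · rw [if_pos h, if_pos (h1.mp h), h, re_I_zpow]
  · rw [if_neg h, if_neg (mt h1.mpr h)]
    simp

/-- The dimension of the space of invariants, as the average of the character. -/
theorem card_mul_finrank_invariants [Fintype G] :
    (Fintype.card G * Module.finrank ℂ (D.coeffRep p lam).invariants : ℤ) =
      ∑ g, minorTrace p (D.mat g) * D.fixedSum lam g := by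
  have hG : (Nat.card G : ℂ) ≠ 0 := by exact_mod_cast Nat.card_pos.ne'
  let _ : Invertible (Nat.card G : ℂ) := invertibleOfNonzero hG
  have h1 := (D.coeffRep p lam).card_inv_mul_sum_char_eq_finrank
  rw [inv_mul_eq_iff_eq_mul₀ hG] at h1
  have h2 : ∑ g, (D.coeffRep p lam).character g =
      ∑ g, LinearMap.trace ℂ _ (D.coeffPullback p lam g) :=
    Equiv.sum_comp (Equiv.inv G) fun g => LinearMap.trace ℂ _ (D.coeffPullback p lam g)
  rw [h2] at h1
  have h3 := congrArg Complex.re h1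
  rw [Complex.re_sum] at h3
  simp only [re_trace_coeffPullback] at h3
  rw [← Int.cast_sum, Nat.card_eq_fintype_card] at h3
  have h4 : ((∑ g, minorTrace p (D.mat g) * D.fixedSum lam g : ℤ) : ℝ) =
      (Fintype.card G * Module.finrank ℂ (D.coeffRep p lam).invariants : ℤ) := by
    rw [h3]
    norm_cast
  exact_mod_cast h4.symm

end HolonomyDatum

open HolonomyDatum

theorem HolonomyDatum.Realizes.eigenMultiplicity_eq_of {G : Type*} [Group G] [Fintype G]
    {n : ℕ} {D : HolonomyDatum G n} {Γ : Subgroup (Isom n)} (hΓ : D.Realizes Γ) {p m : ℕ} {lam : ℝ}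
    (h : ∑ g, minorTrace p (D.mat g) * D.fixedSum lam g = Fintype.card G * m) :
    eigenMultiplicity Γ p lam = m := by
  rw [hΓ.eigenMultiplicity_eq]
  have h1 := D.card_mul_finrank_invariants p lam
  rw [h] at h1
  have h2 : (Fintype.card G : ℤ) ≠ 0 := by exact_mod_cast Fintype.card_ne_zero
  exact_mod_cast mul_left_cancel₀ h2 h1

/-- Two groups with the same matrices are `p`-isospectral if, for every `g` with nonzero trace on
`p`-forms, the two translation parts over `g` differ by an element of the image of `Rᵀ - 1`; this
image is orthogonal to the vectors fixed by `R`. -/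
theorem HolonomyDatum.Realizes.isospectral {G : Type*} [Group G] [Fintype G] {n : ℕ}
    {D D' : HolonomyDatum G n} {Γ Γ' : Subgroup (Isom n)} (hΓ : D.Realizes Γ)
    (hΓ' : D'.Realizes Γ') {p : ℕ} (hmat : D.mat = D'.mat)
    (h : ∀ g, minorTrace p (D.mat g) = 0 ∨
      ∃ u, D'.shift g = D.shift g + (u ᵥ* D.mat g - u)) : Isospectral p Γ Γ' := by
  intro lam
  rw [hΓ'.eigenMultiplicity_eq]
  refine hΓ.eigenMultiplicity_eq_of ?_
  rw [D'.card_mul_finrank_invariants p lam]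
  refine Finset.sum_congr rfl fun g _ => ?_
  rw [← hmat]
  rcases h g with h0 | ⟨u, hu⟩
  · rw [h0, zero_mul, zero_mul]
  · congr 1
    refine Finset.sum_congr rfl fun w _ => ?_
    rw [← hmat]
    split_ifs with hw
    -- `w · (uR - u) = u · (Rw - w) = 0`, so both phases agree on the frequencies fixed by `R`.
    · have h1 : w.1 ⬝ᵥ (u ᵥ* D.mat g - u) = 0 := by
        rw [dotProduct_sub, dotProduct_comm, ← dotProduct_mulVec, hw, dotProduct_comm u, sub_self]
      rw [hu, dotProduct_add, h1, add_zero]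
    · rfl

/-! ### The groups `Γ₆₀` and `Γ₆₁` -/

/-- The integer matrix `B₁`. -/
def intB₁ : Matrix (Fin 4) (Fin 4) ℤ := !![1, 0, 0, 0; 0, 1, 0, 0; 0, 0, 0, 1; 0, 0, -1, 0]

/-- The integer matrix `B₂`. -/
def intB₂ : Matrix (Fin 4) (Fin 4) ℤ := !![-1, 0, 0, 0; 0, 1, 0, 0; 0, 0, 0, 1; 0, 0, 1, 0]

/-- The representation of the dihedral group on `ℤ⁴` under which the rotation `r 1` acts by `B₁`
and the reflection `sr 0` by `B₂`. -/
def dihedralMat : DihedralGroup 4 →* Matrix (Fin 4) (Fin 4) ℤ where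
  toFun
    | .r i => intB₁ ^ i.val
    | .sr i => intB₂ * intB₁ ^ i.val
  map_one' := by decide +kernel
  map_mul' := by decide +kernel

/-- Four times the translation part of the `i`-th power of `x ↦ B₁ x + t / 4`. -/
def rotationShift (t : Fin 4 → ℤ) : ℕ → Fin 4 → ℤ
  | 0 => 0
  | i + 1 => t + intB₁ *ᵥ rotationShift t i

/-- Four times the translation parts of the products of `x ↦ B₁ x + t / 4` and
`x ↦ B₂ x + e₂ / 2` that represent the elements of the dihedral group. -/
def dihedralShift (t : Fin 4 → ℤ) : DihedralGroup 4 → Fin 4 → ℤ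
  | .r i => rotationShift t i.val
  | .sr i => ![0, 2, 0, 0] + intB₂ *ᵥ rotationShift t i.val

/-- The holonomy data of `Γ₆₀`. -/
def datum₆₀ : HolonomyDatum (DihedralGroup 4) 4 where
  mat := dihedralMat
  orthogonal := by decide +kernel
  shift := dihedralShift ![1, 0, 0, 0]
  cocycle := by decide +kernel

/-- The holonomy data of `Γ₆₁`. -/
def datum₆₁ : HolonomyDatum (DihedralGroup 4) 4 where
  mat := dihedralMat
  orthogonal := by decide +kernel
  shift := dihedralShift ![1, 0, 2, 0]
  cocycle := by decide +kernel

theorem dihedralMat_injective : Function.Injective dihedralMat := by decide +kernel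

theorem closure_r_sr : Subgroup.closure {DihedralGroup.r 1, .sr 0} =
    (⊤ : Subgroup (DihedralGroup 4)) := by
  rw [eq_top_iff]
  have h1 : DihedralGroup.r 1 ∈ Subgroup.closure {DihedralGroup.r (1 : ZMod 4), .sr 0} :=
    Subgroup.subset_closure (Or.inl rfl)
  have h2 : DihedralGroup.sr 0 ∈ Subgroup.closure {DihedralGroup.r (1 : ZMod 4), .sr 0} :=
    Subgroup.subset_closure (Or.inr rfl)
  have hr : ∀ i : ZMod 4, DihedralGroup.r i ∈
      Subgroup.closure {DihedralGroup.r (1 : ZMod 4), .sr 0} := fun i => by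
    have := pow_mem h1 i.val
    rwa [DihedralGroup.r_one_pow, ZMod.natCast_zmod_val] at this
  rintro (i | i) -
  · exact hr i
  · simpa using mul_mem h2 (hr i)

theorem liesOver_motion_B₂ (D : HolonomyDatum (DihedralGroup 4) 4) (hmat : D.mat = dihedralMat)
    (hshift : D.shift (.sr 0) = ![0, 2, 0, 0]) :
    D.LiesOver (motion B₂ !₂[0, 1 / 2, 0, 0]) (.sr 0) := by
  have h : dihedralMat (.sr 0) = intB₂ := by decide +kernel
  refine ⟨![0, 2, 0, 0], fun i => by simp [hshift], fun x i => ?_⟩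
  rw [motion_apply, hmat, h, intMatCLM_apply]
  fin_cases i <;> simp [B₂, intB₂, Matrix.mulVec, dotProduct, Fin.sum_univ_four]
  norm_num

/-- The translation part is `B₁ (e₁ / 4 + c e₄ / 4) = (e₁ + c e₃) / 4`. -/
theorem liesOver_motion_B₁ (D : HolonomyDatum (DihedralGroup 4) 4) (hmat : D.mat = dihedralMat)
    (c : ℤ) (hshift : D.shift (.r 1) = ![1, 0, c, 0]) :
    D.LiesOver (motion B₁ !₂[1 / 4, 0, 0, c / 4]) (.r 1) := by
  have h : dihedralMat (.r 1) = intB₁ := by decide +kernel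
  refine ⟨![1, 0, c, 0], fun i => by simp [hshift], fun x i => ?_⟩
  rw [motion_apply, hmat, h, intMatCLM_apply]
  fin_cases i <;> simp [B₁, intB₁, Matrix.mulVec, dotProduct, Fin.sum_univ_four]

theorem realizes_of_liesOver {D : HolonomyDatum (DihedralGroup 4) 4} {γ δ : Isom 4}
    (hγ : D.LiesOver γ (.r 1)) (hδ : D.LiesOver δ (.sr 0)) :
    D.Realizes (Subgroup.closure ({γ, δ} ∪ translation '' canonicalLattice 4)) := by
  refine D.realizes_closure closure_r_sr ?_ ?_
  · rintro _ (rfl | rfl)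
    · exact ⟨_, hγ⟩
    · exact ⟨_, hδ⟩
  · rintro _ (rfl | rfl)
    · exact ⟨γ, Or.inl rfl, hγ⟩
    · exact ⟨δ, Or.inr rfl, hδ⟩

theorem realizes_Γ₆₀ : datum₆₀.Realizes Γ₆₀ := by
  refine realizes_of_liesOver ?_ (liesOver_motion_B₂ _ rfl (by decide +kernel))
  have := liesOver_motion_B₁ datum₆₀ rfl 0 (by decide +kernel)
  simpa using this

theorem realizes_Γ₆₁ : datum₆₁.Realizes Γ₆₁ := by
  refine realizes_of_liesOver ?_ (liesOver_motion_B₂ _ rfl (by decide +kernel))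
  have := liesOver_motion_B₁ datum₆₁ rfl 2 (by decide +kernel)
  convert this using 3
  norm_num

/-- The covectors `e₁` and `e₂` are fixed by the rotations and by the reflections respectively, and
pair to a non-integer with the translation parts. -/
theorem exists_fixed_covector (t : Fin 4 → ℤ)
    (ht : t ∈ ({![1, 0, 0, 0], ![1, 0, 2, 0]} : Finset (Fin 4 → ℤ))) (g : DihedralGroup 4)
    (hg : g ≠ 1) : ∃ w, w ᵥ* dihedralMat g = w ∧ ¬ 4 ∣ w ⬝ᵥ dihedralShift t g := by
  have h : ∀ t ∈ ({![1, 0, 0, 0], ![1, 0, 2, 0]} : Finset (Fin 4 → ℤ)), ∀ g ≠ 1,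
      ∃ w ∈ ({![1, 0, 0, 0], ![0, 1, 0, 0]} : Finset (Fin 4 → ℤ)),
        w ᵥ* dihedralMat g = w ∧ ¬ 4 ∣ w ⬝ᵥ dihedralShift t g := by decide +kernel
  obtain ⟨w, -, hw⟩ := h t ht g hg
  exact ⟨w, hw⟩

/-! ### Multiplicities for `Γ₆₀` and `Γ₆₁` -/

/-- The eight vectors of norm one in `ℤ⁴`. -/
def unitVectors : Finset (Fin 4 → ℤ) :=
  {v ∈ Fintype.piFinset fun _ => {-1, 0, 1} | ∑ i, v i ^ 2 = 1}

theorem mem_unitVectors (v : Fin 4 → ℤ) :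
    v ∈ unitVectors ↔ v ∈ frequencies 4 (4 * Real.pi ^ 2) := by
  have h1 : v ∈ frequencies 4 (4 * Real.pi ^ 2) ↔ ∑ i, v i ^ 2 = 1 := by
    show 4 * Real.pi ^ 2 * ((∑ i, v i ^ 2 : ℤ) : ℝ) = 4 * Real.pi ^ 2 ↔ _
    rw [mul_eq_left₀ (by positivity)]
    exact_mod_cast Iff.rfl
  rw [h1, unitVectors, Finset.mem_filter, and_iff_right_iff_imp, Fintype.mem_piFinset]
  intro h i
  have h2 : v i ^ 2 ≤ 1 := h ▸
    Finset.single_le_sum (f := fun i => v i ^ 2) (fun i _ => sq_nonneg _) (Finset.mem_univ i)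
  have h3 : -1 ≤ v i := by nlinarith
  have h4 : v i ≤ 1 := by nlinarith
  simp only [Finset.mem_insert, Finset.mem_singleton]
  omega

/-- The sum `fixedSum` at the eigenvalue `4π²`, in a form that can be evaluated. -/
def unitFixedSum (D : HolonomyDatum (DihedralGroup 4) 4) (g : DihedralGroup 4) : ℤ :=
  ∑ w ∈ unitVectors, if D.mat g *ᵥ w = w then quarterCos (w ⬝ᵥ D.shift g) else 0

theorem fixedSum_four_pi_sq (D : HolonomyDatum (DihedralGroup 4) 4) (g : DihedralGroup 4) :
    D.fixedSum (4 * Real.pi ^ 2) g = unitFixedSum D g :=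
  (Finset.sum_subtype unitVectors mem_unitVectors
    fun w => if D.mat g *ᵥ w = w then quarterCos (w ⬝ᵥ D.shift g) else 0).symm

theorem eigenMultiplicity_four_pi_sq {D : HolonomyDatum (DihedralGroup 4) 4}
    {Γ : Subgroup (Isom 4)} (hΓ : D.Realizes Γ) {p m : ℕ}
    (h : ∑ g, minorTrace p (D.mat g) * unitFixedSum D g = 8 * m) :
    eigenMultiplicity Γ p (4 * Real.pi ^ 2) = m := by
  refine hΓ.eigenMultiplicity_eq_of ?_
  simp only [fixedSum_four_pi_sq]
  rw [h, DihedralGroup.card]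
  norm_num

theorem isospectral_of_odd {p : ℕ} (hp : p = 1 ∨ p = 3) : Isospectral p Γ₆₀ Γ₆₁ := by
  refine realizes_Γ₆₀.isospectral realizes_Γ₆₁ rfl fun g => ?_
  -- The covectors `∓(e₃ + e₄)` serve for the rotations by `B₁` and `B₁³`.
  have h : ∀ p ∈ ({1, 3} : Finset ℕ), ∀ g, minorTrace p (datum₆₀.mat g) = 0 ∨
      ∃ u ∈ ({0, ![0, 0, 1, 1], ![0, 0, -1, -1]} : Finset (Fin 4 → ℤ)),
        datum₆₁.shift g = datum₆₀.shift g + (u ᵥ* datum₆₀.mat g - u) := by decide +kernel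
  refine (h p (by simpa using hp) g).imp_right ?_
  rintro ⟨u, -, hu⟩
  exact ⟨u, hu⟩

end FlatManifold

end

open FlatManifold
theorem mainTheorem5 :
    (IsBieberbach Γ₆₀ ∧ HasCanonicalLattice Γ₆₀ ∧ Nonempty (Holonomy Γ₆₀ ≃* DihedralGroup 4)) ∧
    (IsBieberbach Γ₆₁ ∧ HasCanonicalLattice Γ₆₁ ∧ Nonempty (Holonomy Γ₆₁ ≃* DihedralGroup 4)) ∧
    (Isospectral 1 Γ₆₀ Γ₆₁ ∧ Isospectral 3 Γ₆₀ Γ₆₁) ∧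
    (¬ Isospectral 0 Γ₆₀ Γ₆₁ ∧ ¬ Isospectral 2 Γ₆₀ Γ₆₁ ∧ ¬ Isospectral 4 Γ₆₀ Γ₆₁) ∧
    (eigenMultiplicity Γ₆₀ 0 (4 * Real.pi ^ 2) = 1 ∧ eigenMultiplicity Γ₆₁ 0 (4 * Real.pi ^ 2) = 0) ∧
    (eigenMultiplicity Γ₆₀ 2 (4 * Real.pi ^ 2) = 8 ∧ eigenMultiplicity Γ₆₁ 2 (4 * Real.pi ^ 2) = 10) ∧
    (eigenMultiplicity Γ₆₀ 4 (4 * Real.pi ^ 2) = 1 ∧ eigenMultiplicity Γ₆₁ 4 (4 * Real.pi ^ 2) = 0) := by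
  have a0 : eigenMultiplicity Γ₆₀ 0 (4 * Real.pi ^ 2) = (1 : ℕ) :=
    eigenMultiplicity_four_pi_sq realizes_Γ₆₀ (by decide +kernel)
  have b0 : eigenMultiplicity Γ₆₁ 0 (4 * Real.pi ^ 2) = (0 : ℕ) :=
    eigenMultiplicity_four_pi_sq realizes_Γ₆₁ (by decide +kernel)
  have a2 : eigenMultiplicity Γ₆₀ 2 (4 * Real.pi ^ 2) = (8 : ℕ) :=
    eigenMultiplicity_four_pi_sq realizes_Γ₆₀ (by decide +kernel)
  have b2 : eigenMultiplicity Γ₆₁ 2 (4 * Real.pi ^ 2) = (10 : ℕ) :=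
    eigenMultiplicity_four_pi_sq realizes_Γ₆₁ (by decide +kernel)
  have a4 : eigenMultiplicity Γ₆₀ 4 (4 * Real.pi ^ 2) = (1 : ℕ) :=
    eigenMultiplicity_four_pi_sq realizes_Γ₆₀ (by decide +kernel)
  have b4 : eigenMultiplicity Γ₆₁ 4 (4 * Real.pi ^ 2) = (0 : ℕ) :=
    eigenMultiplicity_four_pi_sq realizes_Γ₆₁ (by decide +kernel)
  have hne : ∀ {p k l : ℕ}, eigenMultiplicity Γ₆₀ p (4 * Real.pi ^ 2) = k →
      eigenMultiplicity Γ₆₁ p (4 * Real.pi ^ 2) = l → k ≠ l → ¬ Isospectral p Γ₆₀ Γ₆₁ :=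
    fun hk hl hkl h => hkl (Nat.cast_injective (hk.symm.trans ((h _).trans hl)))
  refine ⟨⟨realizes_Γ₆₀.isBieberbach (exists_fixed_covector _ (by simp)),
      realizes_Γ₆₀.hasCanonicalLattice dihedralMat_injective,
      realizes_Γ₆₀.nonempty_holonomy_mulEquiv dihedralMat_injective⟩,
    ⟨realizes_Γ₆₁.isBieberbach (exists_fixed_covector _ (by simp)),
      realizes_Γ₆₁.hasCanonicalLattice dihedralMat_injective,
      realizes_Γ₆₁.nonempty_holonomy_mulEquiv dihedralMat_injective⟩,
    ⟨isospectral_of_odd (Or.inl rfl), isospectral_of_odd (Or.inr rfl)⟩,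
    ⟨hne a0 b0 (by decide), hne a2 b2 (by decide), hne a4 b4 (by decide)⟩,
    ⟨by simpa using a0, by simpa using b0⟩, ⟨by simpa using a2, by simpa using b2⟩,
    ⟨by simpa using a4, by simpa using b4⟩⟩
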